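/- Work in the language $\{0,1,+,\cdot,<,\in\}$ of second-order arithmetic. Let $\mathsf{RCA}_0$ be the theory consisting of the basic axioms on $0,1,+,\cdot,<$, induction for $\Sigma^0_1$ formulae and comprehension for $\Delta^0_1$ formulae (both with parameters). In this language, rational numbers are coded by natural numbers; a real number is a sequence $(q_i)$ of rationals with $|q_i-q_j|\le 2^{-i}$ for $i\le j$; a partial continuous function $f:[0,1]\to\mathbb R$ is a set of pairs $(U,V)$, with $U=(p,q)\cap[0,1]\neq\varnothing$ and $V=(r,s)\neq\varnothing$ rational open intervals, such that (i) $(U,V),(U,V')\in f$ implies $V\cap V'\ne\varnothing$, (ii) $(U,V)\in f$ and $U'\subseteq U$ imply $(U',V)\in f$, (iii) $(U,V)\in f$ and $V\subseteq V'$ imply $(U,V')\in f$. It is total if for every real $x\in[0,1]$ and every rational $\varepsilon>0$ there is $(U,V)\in f$ such that $x\in U$ and $V$ has length at most $\varepsilon$; then $f(x)$ is the real, unique up to equality of reals, that lies in $\overline V$ whenever $(U,V)\in f$ and $x\in U$. It is a gauge if $f(x)>0$ for all reals $x\in[0,1]$. A tagged partition is a finite sequence of reals $0=x_0<t_0<x_1<\dots<t_{\ell-1}<x_\ell=1$;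 it is $f$-fine if $t_j-f(t_j)\le x_j$ and $t_j+f(t_j)\ge x_{j+1}$ for all $j<\ell$. Let $\mathsf{CL}_{\mathrm c}$ be the sentence "every total continuous gauge $f$ on $[0,1]$ has an $f$-fine tagged partition". Let $\mathrm{REC}$ be the $\omega$-model whose sets are exactly the computable subsets of $\mathbb N$. A real number is computable if it is the limit of a computable sequence of rationals $(q_i)$ with $|q_i-q_j|\le 2^{-i}$ for $i\le j$. **Theorem.** $\mathsf{RCA}_0$ does not prove $\mathsf{CL}_{\mathrm c}$. In fact $\mathrm{REC}$ is a model of $\mathsf{RCA}_0$ in which $\mathsf{CL}_{\mathrm c}$ is false, and a counterexample can be obtained as follows. There is a computable sequence $\psi(n)=(p_n,q_n)$ of pairs of rationals such that the $\Pi^0_1$ class $$K=[0,1]\setminus\bigcup_{n}(p_n,q_n)$$ is nonempty and contains no computable real, and such that, with the spikes $\mathrm{sp}_n(x)=\max\{0,\min\{\tfrac12,\,x-p_n,\,q_n-x\}\}$, the function $$\delta(x)=\sum_{n=0}^\infty 2^{-n-2}\,\mathrm{sp}_n(x)$$ has the following properties. 1. $|\delta(x)-\delta(y)|\le|x-y|$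 for all real $x,y$. 2. For $x\in[0,1]$, $\delta(x)>0$ if and only if $x\notin K$; in particular $\delta(x)>0$ at every computable $x\in[0,1]$. 3. There is no tagged partition $0=x_0<t_0<x_1<\dots<t_{\ell-1}<x_\ell=1$ consisting of computable reals with $t_j-\delta(t_j)\le x_j$ and $x_{j+1}\le t_j+\delta(t_j)$ for all $j<\ell$. 4. There is a computable set $f$ of pairs $(U,V)$ of rational intervals which codes $\delta$ on $[0,1]$: $\delta(U)\subseteq V$ for all $(U,V)\in f$, and for every real $x\in[0,1]$ and rational $\varepsilon>0$ there is $(U,V)\in f$ with $x\in U$ and $V$ of length at most $\varepsilon$. Moreover $\mathrm{REC}$ satisfies "$f$ is a total continuous gauge" and does not satisfy "there is an $f$-fine tagged partition". -/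

import Mathlib

namespace SOA

/-! ### The language of second-order arithmetic

Terms and formulae are well-scoped, with de Bruijn indices: `Formula n m` has its free number
variables in `Fin n` and its free set variables in `Fin m`; a quantifier binds the index `0`. -/

/-- Numerical terms with free variables among `n` number variables. -/
inductive Term (n : ℕ) : Type
  | var : Fin n → Term n
  | zero : Term n
  | one : Term n
  | add : Term n → Term n → Term n
  | mul : Term n → Term n → Term n

/-- Set terms: there are only the set variables. -/
structure SetVar (m : ℕ) : Type where
  idx : Fin m

/-- Formulae of the language `{0, 1, +, ·, <, ∈}` (with equality of numbers). -/
inductive Formula : ℕ → ℕ → Type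
  | eq {n m : ℕ} : Term n → Term n → Formula n m
  | lt {n m : ℕ} : Term n → Term n → Formula n m
  | mem {n m : ℕ} : Term n → SetVar m → Formula n m
  | neg {n m : ℕ} : Formula n m → Formula n m
  | and {n m : ℕ} : Formula n m → Formula n m → Formula n m
  | or {n m : ℕ} : Formula n m → Formula n m → Formula n m
  | imp {n m : ℕ} : Formula n m → Formula n m → Formula n m
  | iff {n m : ℕ} : Formula n m → Formula n m → Formula n m
  | all {n m : ℕ} : Formula (n + 1) m → Formula n m
  | ex {n m : ℕ} : Formula (n + 1) m → Formula n m
  | allSet {n m : ℕ} : Formula n (m + 1) → Formula n m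
  | exSet {n m : ℕ} : Formula n (m + 1) → Formula n m

/-- Sentences are formulae without free variables. -/
abbrev Sentence : Type := Formula 0 0

/-- Simultaneous substitution of terms for the number variables of a term. -/
def Term.subst {n k : ℕ} (σ : Fin n → Term k) : Term n → Term k
  | .var i => σ i
  | .zero => .zero
  | .one => .one
  | .add s t => .add (s.subst σ) (t.subst σ)
  | .mul s t => .mul (s.subst σ) (t.subst σ)

/-- Weakening of a term by a new number variable with index `0`. -/
def Term.lift {n : ℕ} (t : Term n) : Term (n + 1) := t.subst fun i => .var i.succ

/-- Weakening of a set variable by a new set variable with index `0`. -/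
def SetVar.lift {m : ℕ} (X : SetVar m) : SetVar (m + 1) := ⟨X.idx.succ⟩

instance {n : ℕ} : Coe (Term n) (Term (n + 1)) := ⟨Term.lift⟩
instance {m : ℕ} : Coe (SetVar m) (SetVar (m + 1)) := ⟨SetVar.lift⟩

/-- Simultaneous capture-avoiding substitution of terms for number variables and of set variables
for set variables. -/
def Formula.subst : {n m k l : ℕ} → (Fin n → Term k) → (Fin m → SetVar l) →
    Formula n m → Formula k l
  | _, _, _, _, σ, _, .eq s t => .eq (s.subst σ) (t.subst σ)
  | _, _, _, _, σ, _, .lt s t => .lt (s.subst σ) (t.subst σ)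
  | _, _, _, _, σ, τ, .mem t X => .mem (t.subst σ) (τ X.idx)
  | _, _, _, _, σ, τ, .neg φ => .neg (φ.subst σ τ)
  | _, _, _, _, σ, τ, .and φ ψ => .and (φ.subst σ τ) (ψ.subst σ τ)
  | _, _, _, _, σ, τ, .or φ ψ => .or (φ.subst σ τ) (ψ.subst σ τ)
  | _, _, _, _, σ, τ, .imp φ ψ => .imp (φ.subst σ τ) (ψ.subst σ τ)
  | _, _, _, _, σ, τ, .iff φ ψ => .iff (φ.subst σ τ) (ψ.subst σ τ)
  | _, _, _, _, σ, τ, .all φ => .all (φ.subst (Fin.cons (.var 0) fun i => (σ i).lift) τ)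
  | _, _, _, _, σ, τ, .ex φ => .ex (φ.subst (Fin.cons (.var 0) fun i => (σ i).lift) τ)
  | _, _, _, _, σ, τ, .allSet φ => .allSet (φ.subst σ (Fin.cons ⟨0⟩ fun i => (τ i).lift))
  | _, _, _, _, σ, τ, .exSet φ => .exSet (φ.subst σ (Fin.cons ⟨0⟩ fun i => (τ i).lift))

/-- Weakening of a formula by a new number variable. -/
def Formula.liftN {n m : ℕ} (φ : Formula n m) : Formula (n + 1) m :=
  φ.subst (fun i => .var i.succ) fun X => ⟨X⟩

/-- Weakening of a formula by a new set variable. -/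
def Formula.liftS {n m : ℕ} (φ : Formula n m) : Formula n (m + 1) :=
  φ.subst .var fun X => ⟨X.succ⟩

/-- `φ[t]`: the term `t` is substituted for the number variable with index `0`. -/
def Formula.inst {n m : ℕ} (φ : Formula (n + 1) m) (t : Term n) : Formula n m :=
  φ.subst (Fin.cons t .var) fun X => ⟨X⟩

/-- `φ[Y]`: the set variable `Y` is substituted for the set variable with index `0`. -/
def Formula.instSet {n m : ℕ} (φ : Formula n (m + 1)) (Y : SetVar m) : Formula n m :=
  φ.subst .var (Fin.cons Y fun X => ⟨X⟩)

/-- A sentence, regarded as a formula with any free variables. -/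
def Formula.ofSentence {n m : ℕ} (φ : Sentence) : Formula n m :=
  φ.subst (fun i => i.elim0) fun X => X.elim0

/-- Universal quantification over all free set variables. -/
def Formula.closeSets {n : ℕ} : {m : ℕ} → Formula n m → Formula n 0
  | 0, φ => φ
  | _ + 1, φ => Formula.closeSets (.allSet φ)

/-- Universal quantification over all free number variables. -/
def Formula.closeNumbers {m : ℕ} : {n : ℕ} → Formula n m → Formula 0 m
  | 0, φ => φ
  | _ + 1, φ => Formula.closeNumbers (.all φ)

/-- The universal closure of a formula. -/
def Formula.closure {n m : ℕ} (φ : Formula n m) : Sentence := φ.closeSets.closeNumbers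

/-! ### Provability -/

/-- Natural deduction for classical two-sorted first-order logic with equality of numbers:
`Derives T Γ φ` says that `φ` is derivable from the sentences in `T` and the assumptions `Γ`. -/
inductive Derives (T : Set Sentence) : {n m : ℕ} → List (Formula n m) → Formula n m → Prop
  | ax {n m : ℕ} {Γ : List (Formula n m)} {φ : Sentence} :
      φ ∈ T → Derives T Γ (Formula.ofSentence φ)
  | assumption {n m : ℕ} {Γ : List (Formula n m)} {φ : Formula n m} : φ ∈ Γ → Derives T Γ φ
  | negI {n m : ℕ} {Γ : List (Formula n m)} {φ ψ : Formula n m} :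
      Derives T (φ :: Γ) ψ → Derives T (φ :: Γ) (.neg ψ) → Derives T Γ (.neg φ)
  | byContra {n m : ℕ} {Γ : List (Formula n m)} {φ ψ : Formula n m} :
      Derives T (.neg φ :: Γ) ψ → Derives T (.neg φ :: Γ) (.neg ψ) → Derives T Γ φ
  | andI {n m : ℕ} {Γ : List (Formula n m)} {φ ψ : Formula n m} :
      Derives T Γ φ → Derives T Γ ψ → Derives T Γ (.and φ ψ)
  | andE₁ {n m : ℕ} {Γ : List (Formula n m)} {φ ψ : Formula n m} :
      Derives T Γ (.and φ ψ) → Derives T Γ φ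
  | andE₂ {n m : ℕ} {Γ : List (Formula n m)} {φ ψ : Formula n m} :
      Derives T Γ (.and φ ψ) → Derives T Γ ψ
  | orI₁ {n m : ℕ} {Γ : List (Formula n m)} {φ ψ : Formula n m} :
      Derives T Γ φ → Derives T Γ (.or φ ψ)
  | orI₂ {n m : ℕ} {Γ : List (Formula n m)} {φ ψ : Formula n m} :
      Derives T Γ ψ → Derives T Γ (.or φ ψ)
  | orE {n m : ℕ} {Γ : List (Formula n m)} {φ ψ χ : Formula n m} :
      Derives T Γ (.or φ ψ) → Derives T (φ :: Γ) χ → Derives T (ψ :: Γ) χ → Derives T Γ χ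
  | impI {n m : ℕ} {Γ : List (Formula n m)} {φ ψ : Formula n m} :
      Derives T (φ :: Γ) ψ → Derives T Γ (.imp φ ψ)
  | impE {n m : ℕ} {Γ : List (Formula n m)} {φ ψ : Formula n m} :
      Derives T Γ (.imp φ ψ) → Derives T Γ φ → Derives T Γ ψ
  | iffI {n m : ℕ} {Γ : List (Formula n m)} {φ ψ : Formula n m} :
      Derives T (φ :: Γ) ψ → Derives T (ψ :: Γ) φ → Derives T Γ (.iff φ ψ)
  | iffE₁ {n m : ℕ} {Γ : List (Formula n m)} {φ ψ : Formula n m} :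
      Derives T Γ (.iff φ ψ) → Derives T Γ φ → Derives T Γ ψ
  | iffE₂ {n m : ℕ} {Γ : List (Formula n m)} {φ ψ : Formula n m} :
      Derives T Γ (.iff φ ψ) → Derives T Γ ψ → Derives T Γ φ
  | allI {n m : ℕ} {Γ : List (Formula n m)} {φ : Formula (n + 1) m} :
      Derives T (Γ.map Formula.liftN) φ → Derives T Γ (.all φ)
  | allE {n m : ℕ} {Γ : List (Formula n m)} {φ : Formula (n + 1) m} (t : Term n) :
      Derives T Γ (.all φ) → Derives T Γ (φ.inst t)
  | exI {n m : ℕ} {Γ : List (Formula n m)} {φ : Formula (n + 1) m} (t : Term n) :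
      Derives T Γ (φ.inst t) → Derives T Γ (.ex φ)
  | exE {n m : ℕ} {Γ : List (Formula n m)} {φ : Formula (n + 1) m} {ψ : Formula n m} :
      Derives T Γ (.ex φ) → Derives T (φ :: Γ.map Formula.liftN) ψ.liftN → Derives T Γ ψ
  | allSetI {n m : ℕ} {Γ : List (Formula n m)} {φ : Formula n (m + 1)} :
      Derives T (Γ.map Formula.liftS) φ → Derives T Γ (.allSet φ)
  | allSetE {n m : ℕ} {Γ : List (Formula n m)} {φ : Formula n (m + 1)} (Y : SetVar m) :
      Derives T Γ (.allSet φ) → Derives T Γ (φ.instSet Y)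
  | exSetI {n m : ℕ} {Γ : List (Formula n m)} {φ : Formula n (m + 1)} (Y : SetVar m) :
      Derives T Γ (φ.instSet Y) → Derives T Γ (.exSet φ)
  | exSetE {n m : ℕ} {Γ : List (Formula n m)} {φ : Formula n (m + 1)} {ψ : Formula n m} :
      Derives T Γ (.exSet φ) → Derives T (φ :: Γ.map Formula.liftS) ψ.liftS → Derives T Γ ψ
  | eqRefl {n m : ℕ} {Γ : List (Formula n m)} (t : Term n) : Derives T Γ (.eq t t)
  | eqSubst {n m : ℕ} {Γ : List (Formula n m)} {φ : Formula (n + 1) m} (s t : Term n) :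
      Derives T Γ (.eq s t) → Derives T Γ (φ.inst s) → Derives T Γ (φ.inst t)

/-- The theory `T` proves the sentence `φ`. -/
def Proves (T : Set Sentence) (φ : Sentence) : Prop := Derives T [] φ

/-! ### `ω`-models -/

/-- The value of a numerical term in `ℕ`. -/
def Term.eval {n : ℕ} (v : Fin n → ℕ) : Term n → ℕ
  | .var i => v i
  | .zero => 0
  | .one => 1
  | .add s t => s.eval v + t.eval v
  | .mul s t => s.eval v * t.eval v

/-- Truth of a formula in the `ω`-model `M ⊆ 𝒫(ℕ)`, under an assignment of its free variables. -/
def Formula.Holds (M : Set (Set ℕ)) : {n m : ℕ} → Formula n m →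
    (Fin n → ℕ) → (Fin m → Set ℕ) → Prop
  | _, _, .eq s t, v, _ => s.eval v = t.eval v
  | _, _, .lt s t, v, _ => s.eval v < t.eval v
  | _, _, .mem t X, v, w => t.eval v ∈ w X.idx
  | _, _, .neg φ, v, w => ¬ φ.Holds M v w
  | _, _, .and φ ψ, v, w => φ.Holds M v w ∧ ψ.Holds M v w
  | _, _, .or φ ψ, v, w => φ.Holds M v w ∨ ψ.Holds M v w
  | _, _, .imp φ ψ, v, w => φ.Holds M v w → ψ.Holds M v w
  | _, _, .iff φ ψ, v, w => φ.Holds M v w ↔ ψ.Holds M v w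
  | _, _, .all φ, v, w => ∀ a : ℕ, φ.Holds M (Fin.cons a v) w
  | _, _, .ex φ, v, w => ∃ a : ℕ, φ.Holds M (Fin.cons a v) w
  | _, _, .allSet φ, v, w => ∀ A ∈ M, φ.Holds M v (Fin.cons A w)
  | _, _, .exSet φ, v, w => ∃ A ∈ M, φ.Holds M v (Fin.cons A w)

/-- Truth of a sentence in an `ω`-model. -/
def Models (M : Set (Set ℕ)) (φ : Sentence) : Prop := φ.Holds M ![] ![]

/-- The `ω`-model of the computable sets. -/
def REC : Set (Set ℕ) := {A | ComputablePred fun k => k ∈ A}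

/-! ### Connectives and binders used to write formulae

`allN fun x => φ` and the like give a name to the variable that the quantifier binds. -/

def allN {n m : ℕ} (F : Term (n + 1) → Formula (n + 1) m) : Formula n m := .all (F (.var 0))

def exN {n m : ℕ} (F : Term (n + 1) → Formula (n + 1) m) : Formula n m := .ex (F (.var 0))

def allS {n m : ℕ} (F : SetVar (m + 1) → Formula n (m + 1)) : Formula n m := .allSet (F ⟨0⟩)

def exS {n m : ℕ} (F : SetVar (m + 1) → Formula n (m + 1)) : Formula n m := .exSet (F ⟨0⟩)

def le {n m : ℕ} (s t : Term n) : Formula n m := .or (.lt s t) (.eq s t)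

local infixl:65 " ∔ " => Term.add
local infixl:70 " ⊡ " => Term.mul
local infix:50 " ≐ " => Formula.eq
local infix:50 " ≺ " => Formula.lt
local infix:50 " ≼ " => le
local infix:50 " ε " => Formula.mem
local infixr:35 " ⊓' " => Formula.and
local infixr:30 " ⊔' " => Formula.or
local infixr:25 " ⇒ " => Formula.imp
local infix:20 " ⇔ " => Formula.iff

/-! ### The system `RCA₀` -/

/-- Formulae all of whose quantifiers are bounded number quantifiers `∀ x < t`, `∃ x < t`. -/
inductive IsBounded : {n m : ℕ} → Formula n m → Prop
  | eq {n m : ℕ} (s t : Term n) : IsBounded (.eq s t : Formula n m)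
  | lt {n m : ℕ} (s t : Term n) : IsBounded (.lt s t : Formula n m)
  | mem {n m : ℕ} (t : Term n) (X : SetVar m) : IsBounded (.mem t X)
  | neg {n m : ℕ} {φ : Formula n m} : IsBounded φ → IsBounded (.neg φ)
  | and {n m : ℕ} {φ ψ : Formula n m} : IsBounded φ → IsBounded ψ → IsBounded (.and φ ψ)
  | or {n m : ℕ} {φ ψ : Formula n m} : IsBounded φ → IsBounded ψ → IsBounded (.or φ ψ)
  | imp {n m : ℕ} {φ ψ : Formula n m} : IsBounded φ → IsBounded ψ → IsBounded (.imp φ ψ)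
  | iff {n m : ℕ} {φ ψ : Formula n m} : IsBounded φ → IsBounded ψ → IsBounded (.iff φ ψ)
  | ball {n m : ℕ} (t : Term n) {φ : Formula (n + 1) m} :
      IsBounded φ → IsBounded (.all (.imp (.lt (.var 0) t.lift) φ))
  | bex {n m : ℕ} (t : Term n) {φ : Formula (n + 1) m} :
      IsBounded φ → IsBounded (.ex (.and (.lt (.var 0) t.lift) φ))

/-- `Σ⁰₁` formulae: existential number quantifiers in front of a bounded formula. -/
inductive IsSigma01 : {n m : ℕ} → Formula n m → Prop
  | of {n m : ℕ} {φ : Formula n m} : IsBounded φ → IsSigma01 φ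
  | ex {n m : ℕ} {φ : Formula (n + 1) m} : IsSigma01 φ → IsSigma01 (.ex φ)

/-- `Π⁰₁` formulae: universal number quantifiers in front of a bounded formula. -/
inductive IsPi01 : {n m : ℕ} → Formula n m → Prop
  | of {n m : ℕ} {φ : Formula n m} : IsBounded φ → IsPi01 φ
  | all {n m : ℕ} {φ : Formula (n + 1) m} : IsPi01 φ → IsPi01 (.all φ)

/-- The basic axioms on `0, 1, +, ·, <`. -/
def basicAxioms : Set Sentence :=
  {(allN fun x => .neg (x ∔ .one ≐ .zero) : Sentence),
   (allN fun x => allN fun y => (x : Term 2) ∔ .one ≐ y ∔ .one ⇒ (x : Term 2) ≐ y : Sentence),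
   (allN fun x => x ∔ .zero ≐ x : Sentence),
   (allN fun x => allN fun y => (x : Term 2) ∔ (y ∔ .one) ≐ (x : Term 2) ∔ y ∔ .one : Sentence),
   (allN fun x => x ⊡ .zero ≐ .zero : Sentence),
   (allN fun x => allN fun y => (x : Term 2) ⊡ (y ∔ .one) ≐ (x : Term 2) ⊡ y ∔ x : Sentence),
   (allN fun x => .neg (x ≺ .zero) : Sentence),
   (allN fun x => allN fun y =>
     (x : Term 2) ≺ y ∔ .one ⇔ ((x : Term 2) ≺ y ⊔' (x : Term 2) ≐ y) : Sentence)}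

/-- The induction axiom `φ(0) ∧ ∀x (φ(x) → φ(x + 1)) → ∀x φ(x)`, where `x` has index `0` and all
other free variables are parameters. -/
def inductionAxiom {n m : ℕ} (φ : Formula (n + 1) m) : Formula n m :=
  φ.inst .zero ⊓'
    .all (φ ⇒ φ.subst (Fin.cons (.var 0 ∔ .one) fun i => .var i.succ) fun X => ⟨X⟩) ⇒ .all φ

/-- The comprehension axiom `∀x (φ(x) ↔ ψ(x)) → ∃X ∀x (x ∈ X ↔ φ(x))`, where `x` has index `0` and
all other free variables are parameters. -/
def deltaComprehension {n m : ℕ} (φ ψ : Formula (n + 1) m) : Formula n m :=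
  .all (φ ⇔ ψ) ⇒ exS fun X => .all (.var 0 ε X ⇔ φ.liftS)

/-- `RCA₀`: the basic axioms, `Σ⁰₁` induction and `Δ⁰₁` comprehension. -/
def RCA0 : Set Sentence :=
  basicAxioms ∪
  {θ | ∃ (n m : ℕ) (φ : Formula (n + 1) m), IsSigma01 φ ∧ θ = (inductionAxiom φ).closure} ∪
  {θ | ∃ (n m : ℕ) (φ ψ : Formula (n + 1) m), IsSigma01 φ ∧ IsPi01 ψ ∧
    θ = (deltaComprehension φ ψ).closure}

/-! ### Number systems in second-order arithmetic -/

/-- The pair `(s, t)`, coded by the number `(s + t)² + s`. -/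
def pair {n : ℕ} (s t : Term n) : Term n := (s ∔ t) ⊡ (s ∔ t) ∔ s

/-- `(a, b)` is an integer (standing for `a - b`): it is the least among the pairs `(p, q)` with
`a + q = b + p`. -/
def isInt {n m : ℕ} (a b : Term n) : Formula n m :=
  allN fun p => allN fun q => (a : Term (n + 2)) ∔ q ≐ (b : Term (n + 2)) ∔ p ⇒
    pair (a : Term (n + 2)) b ≼ pair (p : Term (n + 2)) q

/-- A representation `(pos - neg) / den` of a rational number by three numerical terms. -/
structure RatTerm (n : ℕ) : Type where
  pos : Term n
  neg : Term n
  den : Term n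

def RatTerm.lift {n : ℕ} (ρ : RatTerm n) : RatTerm (n + 1) := ⟨ρ.pos, ρ.neg, ρ.den⟩

instance {n : ℕ} : Coe (RatTerm n) (RatTerm (n + 1)) := ⟨RatTerm.lift⟩

namespace RatTerm

variable {n m : ℕ}

def zero : RatTerm n := ⟨.zero, .zero, .one⟩

def one : RatTerm n := ⟨.one, .zero, .one⟩

/-- `1 / d` -/
def inv (d : Term n) : RatTerm n := ⟨.one, .zero, d⟩

def add (ρ σ : RatTerm n) : RatTerm n :=
  ⟨ρ.pos ⊡ σ.den ∔ σ.pos ⊡ ρ.den, ρ.neg ⊡ σ.den ∔ σ.neg ⊡ ρ.den, ρ.den ⊡ σ.den⟩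

def sub (ρ σ : RatTerm n) : RatTerm n := ρ.add ⟨σ.neg, σ.pos, σ.den⟩

/-- Equality of rational numbers, by cross multiplication. -/
def eq (ρ σ : RatTerm n) : Formula n m :=
  ρ.pos ⊡ σ.den ∔ σ.neg ⊡ ρ.den ≐ σ.pos ⊡ ρ.den ∔ ρ.neg ⊡ σ.den

def lt (ρ σ : RatTerm n) : Formula n m :=
  ρ.pos ⊡ σ.den ∔ σ.neg ⊡ ρ.den ≺ σ.pos ⊡ ρ.den ∔ ρ.neg ⊡ σ.den

def le (ρ σ : RatTerm n) : Formula n m :=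
  ρ.pos ⊡ σ.den ∔ σ.neg ⊡ ρ.den ≼ σ.pos ⊡ ρ.den ∔ ρ.neg ⊡ σ.den

/-- The number coding the pair of the integers `(pos, neg)` and `(den, 0)`. -/
def code (ρ : RatTerm n) : Term n := pair (pair ρ.pos ρ.neg) (pair ρ.den .zero)

/-- `ρ.code` is a rational number: a pair of an integer and a positive integer, which is the least
in its class of equal fractions. (A positive integer is always of the form `(d, 0)`.) -/
def isRat (ρ : RatTerm n) : Formula n m :=
  isInt ρ.pos ρ.neg ⊓' .zero ≺ ρ.den ⊓'
    allN fun a => allN fun b => allN fun d =>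
      isInt (a : Term (n + 3)) b ⊓' .zero ≺ d ⊓' (ρ : RatTerm (n + 3)).eq ⟨a, b, d⟩ ⇒
        (ρ : RatTerm (n + 3)).code ≼ code ⟨a, b, d⟩

end RatTerm

/-- For all rational numbers `ρ`. -/
def allQ {n m : ℕ} (F : RatTerm (n + 3) → Formula (n + 3) m) : Formula n m :=
  allN fun a => allN fun b => allN fun d =>
    (⟨a, b, d⟩ : RatTerm (n + 3)).isRat ⇒ F ⟨a, b, d⟩

/-- There is a rational number `ρ`. -/
def exQ {n m : ℕ} (F : RatTerm (n + 3) → Formula (n + 3) m) : Formula n m :=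
  exN fun a => exN fun b => exN fun d =>
    (⟨a, b, d⟩ : RatTerm (n + 3)).isRat ⊓' F ⟨a, b, d⟩

/-- `y` is the remainder of `c` modulo `(i + 1) * b + 1`, the value at `i` of the finite sequence
coded by `c, b` through Gödel's `β`-function. -/
def betaEq {n m : ℕ} (c b i y : Term n) : Formula n m :=
  y ≺ (i ∔ .one) ⊡ b ∔ .one ⊓'
    exN fun z => (c : Term (n + 1)) ≐ z ⊡ ((i ∔ .one) ⊡ b ∔ .one : Term n) ∔ y

/-- `e = 2 ^ k`: there is a finite sequence starting with `1`, doubling `k` times, and arriving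
at `e`. -/
def isPow2 {n m : ℕ} (k e : Term n) : Formula n m :=
  exN fun c => exN fun b =>
    betaEq (c : Term (n + 2)) b .zero .one ⊓'
    betaEq (c : Term (n + 2)) b k e ⊓'
    allN fun i => allN fun y => (i : Term (n + 4)) ≺ k ⊓' betaEq (c : Term (n + 4)) b i y ⇒
      betaEq (c : Term (n + 4)) b (i ∔ .one : Term (n + 3)) (y ∔ y)

/-- `X` is a sequence of rational numbers, i.e. a function from `ℕ` to `ℚ`, coded as a set of
pairs. -/
def isSeqRat {n m : ℕ} (X : SetVar m) : Formula n m :=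
  (allN fun z => z ε X ⇒ exN fun k => exQ fun ρ =>
    (z : Term (n + 5)) ≐ pair (k : Term (n + 5)) ρ.code)
  ⊓' allN fun k => exN fun c => pair (k : Term (n + 2)) c ε X ⊓'
      allN fun c' => pair (k : Term (n + 3)) c' ε X ⇒ c' ≐ c

/-- For the `k`-th term `ρ` of the sequence of rational numbers `X`. -/
def allVal {n m : ℕ} (X : SetVar m) (k : Term n) (F : RatTerm (n + 3) → Formula (n + 3) m) :
    Formula n m :=
  allQ fun ρ => pair (k : Term (n + 3)) ρ.code ε X ⇒ F ρ

/-- `X` is a real number: a sequence of rational numbers with `|X i - X j| ≤ 2 ^ (-i)` for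
`i ≤ j`. -/
def isReal {n m : ℕ} (X : SetVar m) : Formula n m :=
  isSeqRat X ⊓'
  allN fun i => allN fun j => allN fun e =>
    (i : Term (n + 3)) ≼ j ⊓' isPow2 (i : Term (n + 3)) e ⇒
    allVal X (i : Term (n + 3)) fun ρ => allVal X (j : Term (n + 6)) fun σ =>
      (ρ : RatTerm (n + 9)).le (σ.add (.inv e)) ⊓' σ.le ((ρ : RatTerm (n + 9)).add (.inv e))

/-- `2 · 2 ^ (-k)`, where `e = 2 ^ k`. -/
def twoInv {n : ℕ} (e : Term n) : RatTerm n := (RatTerm.inv e).add (.inv e)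

/-- `X ≤ Y` for real numbers: `X k ≤ Y k + 2 ^ (-k + 1)` for all `k`. -/
def realLe {n m : ℕ} (X Y : SetVar m) : Formula n m :=
  allN fun k => allN fun e => isPow2 (k : Term (n + 2)) e ⇒
    allVal X (k : Term (n + 2)) fun ρ => allVal Y (k : Term (n + 5)) fun σ =>
      (ρ : RatTerm (n + 8)).le (σ.add (twoInv e))

def realLt {n m : ℕ} (X Y : SetVar m) : Formula n m := .neg (realLe Y X)

/-- `X ≤ ρ` for a real number `X` and a rational number `ρ`, identified with the constant
sequence. -/
def realLeRat {n m : ℕ} (X : SetVar m) (ρ : RatTerm n) : Formula n m :=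
  allN fun k => allN fun e => isPow2 (k : Term (n + 2)) e ⇒
    allVal X (k : Term (n + 2)) fun σ => σ.le ((ρ : RatTerm (n + 5)).add (twoInv e))

/-- `ρ ≤ X` for a rational number `ρ` and a real number `X`. -/
def ratLeReal {n m : ℕ} (ρ : RatTerm n) (X : SetVar m) : Formula n m :=
  allN fun k => allN fun e => isPow2 (k : Term (n + 2)) e ⇒
    allVal X (k : Term (n + 2)) fun σ => (ρ : RatTerm (n + 5)).le (σ.add (twoInv e))

def realLtRat {n m : ℕ} (X : SetVar m) (ρ : RatTerm n) : Formula n m := .neg (ratLeReal ρ X)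

def ratLtReal {n m : ℕ} (ρ : RatTerm n) (X : SetVar m) : Formula n m := .neg (realLeRat X ρ)

/-- `X` is a real number in `[0, 1]`. -/
def inUnit {n m : ℕ} (X : SetVar m) : Formula n m :=
  isReal X ⊓' ratLeReal .zero X ⊓' realLeRat X .one

/-- `T - Y ≤ X` for real numbers; the `k`-th term of `T - Y` is `T (k + 1) - Y (k + 1)`. -/
def subLe {n m : ℕ} (T Y X : SetVar m) : Formula n m :=
  allN fun k => allN fun e => isPow2 (k : Term (n + 2)) e ⇒
    allVal T (k ∔ .one : Term (n + 1)) fun τ => allVal Y (k ∔ .one : Term (n + 1)) fun υ =>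
      allVal X (k : Term (n + 8)) fun ξ =>
        ((τ : RatTerm (n + 11)).sub υ).le (ξ.add (twoInv e))

/-- `X ≤ T + Y` for real numbers; the `k`-th term of `T + Y` is `T (k + 1) + Y (k + 1)`. -/
def leAdd {n m : ℕ} (X T Y : SetVar m) : Formula n m :=
  allN fun k => allN fun e => isPow2 (k : Term (n + 2)) e ⇒
    allVal T (k ∔ .one : Term (n + 1)) fun τ => allVal Y (k ∔ .one : Term (n + 1)) fun υ =>
      allVal X (k : Term (n + 8)) fun ξ =>
        ξ.le (((τ : RatTerm (n + 11)).add υ).add (twoInv e))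

/-! ### Continuous functions `[0, 1] → ℝ` in second-order arithmetic -/

/-- `(p, q)` codes a basic open interval `U = (p, q) ∩ [0, 1]` of `[0, 1]`:
`max p 0 < min q 1`. -/
def isBasicUnit {n m : ℕ} (p q : RatTerm n) : Formula n m :=
  p.lt q ⊓' p.lt .one ⊓' RatTerm.zero.lt q

/-- `(p', q') ∩ [0, 1] ⊆ (p, q) ∩ [0, 1]`. -/
def unitSubset {n m : ℕ} (p' q' p q : RatTerm n) : Formula n m :=
  (p.lt .zero ⊔' p.le p') ⊓' (RatTerm.one.lt q ⊔' q'.le q)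

/-- The real number `X` lies in `(p, q) ∩ [0, 1]`. -/
def inInterval {n m : ℕ} (X : SetVar m) (p q : RatTerm n) : Formula n m :=
  inUnit X ⊓' ratLtReal p X ⊓' realLtRat X q

/-- The number coding the pair `(U, V)` of the intervals `U = (p, q) ∩ [0, 1]` and
`V = (r, s)`. -/
def boxCode {n : ℕ} (p q r s : RatTerm n) : Term n :=
  pair (pair p.code q.code) (pair r.code s.code)

/-- The quadruples `p, q, r, s` of rational numbers with the pair `(p, q), (r, s)` in `f`. -/
def allBox {n m : ℕ} (f : SetVar m)
    (F : RatTerm (n + 12) → RatTerm (n + 12) → RatTerm (n + 12) → RatTerm (n + 12) →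
      Formula (n + 12) m) : Formula n m :=
  allQ fun p => allQ fun q => allQ fun r => allQ fun s =>
    boxCode (p : RatTerm (n + 12)) q r s ε f ⇒ F p q r s

def exBox {n m : ℕ} (f : SetVar m)
    (F : RatTerm (n + 12) → RatTerm (n + 12) → RatTerm (n + 12) → RatTerm (n + 12) →
      Formula (n + 12) m) : Formula n m :=
  exQ fun p => exQ fun q => exQ fun r => exQ fun s =>
    boxCode (p : RatTerm (n + 12)) q r s ε f ⊓' F p q r s

/-- `f` is (a code of) a partial continuous function `[0, 1] → ℝ`: a set of pairs `(U, V)` of basic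
open intervals such that
* if `(U, V)` and `(U, V')` are in `f` then `V` and `V'` intersect;
* if `(U, V)` is in `f` and `U' ⊆ U` then `(U', V)` is in `f`;
* if `(U, V)` is in `f` and `V ⊆ V'` then `(U, V')` is in `f`. -/
def isContFun {n m : ℕ} (f : SetVar m) : Formula n m :=
  (allN fun z => z ε f ⇒ exQ fun p => exQ fun q => exQ fun r => exQ fun s =>
    (z : Term (n + 13)) ≐ boxCode (p : RatTerm (n + 13)) q r s ⊓'
      isBasicUnit (p : RatTerm (n + 13)) q ⊓' (r : RatTerm (n + 13)).lt s)
  ⊓' (allBox f fun p q r s => allQ fun r' => allQ fun s' =>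
    boxCode (p : RatTerm (n + 18)) q r' s' ε f ⇒
      (r : RatTerm (n + 18)).lt s' ⊓' (r' : RatTerm (n + 18)).lt s)
  ⊓' (allBox f fun p q r s => allQ fun p' => allQ fun q' =>
    isBasicUnit (p' : RatTerm (n + 18)) q' ⊓' unitSubset (p' : RatTerm (n + 18)) q' p q ⇒
      boxCode (p' : RatTerm (n + 18)) q' r s ε f)
  ⊓' (allBox f fun p q r s => allQ fun r' => allQ fun s' =>
    (r' : RatTerm (n + 18)).le r ⊓' (s : RatTerm (n + 18)).le s' ⇒
      boxCode (p : RatTerm (n + 18)) q r' s' ε f)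

/-- The real number `X` is in the domain of `f`: for every positive rational `η` there is a pair
`(U, V)` in `f` such that `X` is in `U` and `V` has length at most `η`. -/
def inDomain {n m : ℕ} (f X : SetVar m) : Formula n m :=
  allQ fun η => RatTerm.zero.lt η ⇒
    exBox f fun p q r s => inInterval X p q ⊓' (s.sub r).le η

/-- `f` is total. -/
def isTotal {n m : ℕ} (f : SetVar m) : Formula n m :=
  allS fun X => inUnit X ⇒ inDomain f X

/-- The real number `Y` is the value of `f` at `X`: `X` is in the domain of `f`, and `Y` is in the
closure of `V` whenever `(U, V)` is in `f` and `X` is in `U`. -/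
def isValue {n m : ℕ} (f X Y : SetVar m) : Formula n m :=
  inDomain f X ⊓' isReal Y ⊓'
    allBox f fun p q r s => inInterval X p q ⇒ ratLeReal r Y ⊓' realLeRat Y s

/-- `f` is a gauge: `f(X) > 0` for all real numbers `X` in `[0, 1]`. -/
def isGauge {n m : ℕ} (f : SetVar m) : Formula n m :=
  allS fun X => inUnit X ⇒ exS fun Y => isValue (f : SetVar (m + 2)) X Y ⊓' ratLtReal .zero Y

/-! ### Partitions and Cousin's lemma in second-order arithmetic -/

/-- `X` is the real number in place `i` of the sequence of real numbers `P`, which is coded as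
the set of the pairs `(i, z)` with `z` in the `i`-th real number. -/
def isEntry {n m : ℕ} (P : SetVar m) (i : Term n) (X : SetVar m) : Formula n m :=
  isReal X ⊓' allN fun z => z ε X ⇔ pair (i : Term (n + 1)) z ε P

/-- `P` is a tagged partition `x₀, t₀, x₁, …, t_{ℓ-1}, x_ℓ` of `[0, 1]`: a finite sequence of
`2ℓ + 1` real numbers, where `x_j` has place `2j` and `t_j` has place `2j + 1`, such that
`x₀ = 0`, `x_ℓ = 1`, and `x_j < t_j < x_{j+1}` for all `j < ℓ`. -/
def isPartition {n m : ℕ} (P : SetVar m) (ℓ : Term n) : Formula n m :=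
  (allN fun z => z ε P ⇒ exN fun i => exN fun y =>
    (i : Term (n + 3)) ≼ (ℓ ∔ ℓ : Term n) ⊓' (z : Term (n + 3)) ≐ pair (i : Term (n + 3)) y)
  ⊓' (allN fun i => i ≼ (ℓ ∔ ℓ : Term n) ⇒ exS fun X => isEntry P i X)
  ⊓' (exS fun X => isEntry P .zero X ⊓' ratLeReal .zero X ⊓' realLeRat X .zero)
  ⊓' (exS fun X => isEntry P (ℓ ∔ ℓ) X ⊓' ratLeReal .one X ⊓' realLeRat X .one)
  ⊓' (allN fun j => j ≺ ℓ ⇒ exS fun X => exS fun T => exS fun X' =>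
    isEntry (P : SetVar (m + 3)) (j ∔ j) X ⊓'
    isEntry (P : SetVar (m + 3)) (j ∔ j ∔ .one) T ⊓'
    isEntry (P : SetVar (m + 3)) (j ∔ j ∔ .one ∔ .one) X' ⊓'
    realLt (X : SetVar (m + 3)) T ⊓' realLt (T : SetVar (m + 3)) X')

/-- The partition `P` of size `ℓ` is `f`-fine: `t_j - f(t_j) ≤ x_j` and `t_j + f(t_j) ≥ x_{j+1}`
for all `j < ℓ`. -/
def isFine {n m : ℕ} (f P : SetVar m) (ℓ : Term n) : Formula n m :=
  allN fun j => j ≺ ℓ ⇒ exS fun X => exS fun T => exS fun X' => exS fun Y =>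
    isEntry (P : SetVar (m + 4)) (j ∔ j) X ⊓'
    isEntry (P : SetVar (m + 4)) (j ∔ j ∔ .one) T ⊓'
    isEntry (P : SetVar (m + 4)) (j ∔ j ∔ .one ∔ .one) X' ⊓'
    isValue (f : SetVar (m + 4)) T Y ⊓'
    subLe (T : SetVar (m + 4)) Y X ⊓' leAdd (X' : SetVar (m + 4)) T Y

/-- There is an `f`-fine tagged partition of `[0, 1]`. -/
def hasFinePartition {n m : ℕ} (f : SetVar m) : Formula n m :=
  exS fun P => exN fun ℓ => isPartition P ℓ ⊓' isFine (f : SetVar (m + 1)) P ℓ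

/-- `f` is a total continuous gauge. -/
def isTotalContGauge {n m : ℕ} (f : SetVar m) : Formula n m :=
  isContFun f ⊓' isTotal f ⊓' isGauge f

/-- Cousin's lemma for continuous functions, as a sentence of second-order arithmetic. -/
def CLc : Sentence := allS fun f => isTotalContGauge f ⇒ hasFinePartition f

/-! ### Computable reals, `Π⁰₁` classes and the sum of spikes -/

/-- The number `(a + b)² + a`. -/
def natPair (a b : ℕ) : ℕ := (a + b) * (a + b) + a

/-- The code of a rational number: numerator `z` as the integer `(z⁺, z⁻)`, denominator `d` as the
integer `(d, 0)`. -/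
def ratCode (q : ℚ) : ℕ := natPair (natPair q.num.toNat (-q.num).toNat) (natPair q.den 0)

/-- `x` is the limit of a computable sequence of rationals with `|q i - q j| ≤ 2 ^ (-i)` for
`i ≤ j`. -/
def IsComputableReal (x : ℝ) : Prop :=
  ∃ q : ℕ → ℚ, Computable (fun k => ratCode (q k)) ∧
    (∀ i j, i ≤ j → |q i - q j| ≤ (1 / 2) ^ i) ∧
    Filter.Tendsto (fun k => (q k : ℝ)) Filter.atTop (nhds x)

/-- `[0, 1]` minus the union of the intervals `U_{ψ(k)} = (p, q) ∩ [0, 1]`, `(p, q) = ψ k`. -/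
def piClass (ψ : ℕ → ℚ × ℚ) : Set ℝ :=
  Set.Icc 0 1 \ ⋃ k, Set.Ioo ((ψ k).1 : ℝ) ((ψ k).2 : ℝ)

/-- The spike with slopes `±1` on `(p, q)`, cut off at height `1 / 2`. -/
noncomputable def spike (p q : ℚ) (x : ℝ) : ℝ := max 0 (min (1 / 2) (min (x - p) (q - x)))

/-- `∑ₖ 2 ^ (-k - 2) * spₖ(x)`, where `spₖ` is the spike on the interval `ψ k`. -/
noncomputable def spikeSum (ψ : ℕ → ℚ × ℚ) (x : ℝ) : ℝ :=
  ∑' k, (1 / 2) ^ (k + 2) * spike (ψ k).1 (ψ k).2 x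

/-- The set of pairs `f` codes the continuous function `δ` on `[0, 1]`: `δ(U) ⊆ V` for all
pairs `(U, V)` in `f`, and every real number in `[0, 1]` lies in some `U` with `(U, V)` in `f` and
`V` as short as desired. -/
def CodesFunction (f : Set ℕ) (δ : ℝ → ℝ) : Prop :=
  (∀ p q r s : ℚ, natPair (natPair (ratCode p) (ratCode q)) (natPair (ratCode r) (ratCode s)) ∈ f →
    ∀ x ∈ Set.Icc (0 : ℝ) 1, (p : ℝ) < x → x < q → (r : ℝ) < δ x ∧ δ x < s) ∧
  ∀ x ∈ Set.Icc (0 : ℝ) 1, ∀ η : ℚ, 0 < η → ∃ p q r s : ℚ,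
    natPair (natPair (ratCode p) (ratCode q)) (natPair (ratCode r) (ratCode s)) ∈ f ∧
    (p : ℝ) < x ∧ x < q ∧ s - r ≤ η

/-- There is a `δ`-fine tagged partition of `[0, 1]` whose points and tags are computable reals. -/
def HasComputableFinePartition (δ : ℝ → ℝ) : Prop :=
  ∃ (ℓ : ℕ) (x t : ℕ → ℝ), x 0 = 0 ∧ x ℓ = 1 ∧
    (∀ j ≤ ℓ, IsComputableReal (x j)) ∧ (∀ j < ℓ, IsComputableReal (t j)) ∧
    (∀ j < ℓ, x j < t j ∧ t j < x (j + 1)) ∧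
    ∀ j < ℓ, t j - δ (t j) ≤ x j ∧ x (j + 1) ≤ t j + δ (t j)

end SOA

/-! The computable reals are too few to satisfy compactness. Program `e` earns one interval of
radius 2^-(e+3), centred at the rational that it outputs on input e + 4. A computable real has a
fast Cauchy sequence computed by some program, and the interval of that program contains it
(`exists_mem_cover`). The total length is at most 1/2, so a nonempty compact set K of [0,1] is left
over, free of computable reals (`piClass_cover_nonempty`).

The weighted sum δ of spikes on these intervals vanishes on [0,1] exactly at K, so it is positive at
every computable point. The weights add up to 1/2, hence δ has Lipschitz constant 1/2. If a δ-fine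
partition existed, a point y of K would lie within δ(t) of some tag t, and δ(t) = δ(t) - δ(y) ≤ |t -
y|/2 ≤ δ(t)/2 would force δ(t) = 0. So every fine partition has a tag in K, which is not computable
(`not_hasFinePartition`).

What remains is to carry this into second-order arithmetic. A decidable set of boxes (U, V) codes δ:
V must contain an explicit rational enclosure of δ(U), arranged so that enclosures shrink when U
shrinks (`InCode`, `InCode.mono_left`). The formulae about rationals, reals and continuous functions
are evaluated in ω-models, where a set coding a real determines an actual real number; in `REC`
these are the computable reals. Thus `REC` believes that the code is a total gauge and has no fine
partition for it. Since `REC` satisfies `RCA0` (Δ⁰₁ comprehension is Post's theorem, induction holds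
because the numbers are standard), soundness of derivations gives unprovability. -/

namespace SOA

/-! ### Soundness of derivations for `ω`-models -/

@[simp] theorem Term.eval_subst {n k : ℕ} (σ : Fin n → Term k) (v : Fin k → ℕ) (t : Term n) :
    (t.subst σ).eval v = t.eval fun i => (σ i).eval v := by
  induction t with
  | var i => rfl
  | zero => rfl
  | one => rfl
  | add s t hs ht => simp [Term.subst, Term.eval, hs, ht]
  | mul s t hs ht => simp [Term.subst, Term.eval, hs, ht]

@[simp] theorem Term.eval_lift {n : ℕ} (t : Term n) (a : ℕ) (v : Fin n → ℕ) :
    t.lift.eval (Fin.cons a v : Fin (n + 1) → ℕ) = t.eval v := by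
  simp [Term.lift, Term.eval]

theorem Term.eval_cons_lift {n k : ℕ} (σ : Fin n → Term k) (a : ℕ) (v : Fin k → ℕ) :
    (fun i => ((Fin.cons (.var 0) fun i => (σ i).lift : Fin (n + 1) → Term (k + 1)) i).eval
      (Fin.cons a v : Fin (k + 1) → ℕ)) = (Fin.cons a fun i => (σ i).eval v : Fin (n + 1) → ℕ) := by
  funext i
  refine Fin.cases ?_ (fun i => ?_) i <;> simp [Term.eval]

theorem SetVar.idx_cons_lift {m l : ℕ} (τ : Fin m → SetVar l) (A : Set ℕ) (w : Fin l → Set ℕ) :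
    (fun j => (Fin.cons A w : Fin (l + 1) → Set ℕ)
      ((Fin.cons ⟨0⟩ fun i => (τ i).lift : Fin (m + 1) → SetVar (l + 1)) j).idx) =
      (Fin.cons A fun j => w (τ j).idx : Fin (m + 1) → Set ℕ) := by
  funext i
  refine Fin.cases ?_ (fun i => ?_) i <;> simp [SetVar.lift]

/-- The targets `k`, `l` and the substitutions stay universally quantified in the induction, because
passing under a binder enlarges both contexts. -/
theorem Formula.holds_subst (M : Set (Set ℕ)) {n m : ℕ} (φ : Formula n m) :
    ∀ {k l : ℕ} (σ : Fin n → Term k) (τ : Fin m → SetVar l) (v : Fin k → ℕ) (w : Fin l → Set ℕ),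
      (φ.subst σ τ).Holds M v w ↔
        φ.Holds M (fun i => (σ i).eval v) fun j => w (τ j).idx := by
  induction φ with
  | all φ ih | ex φ ih =>
    intro k l σ τ v w
    simp only [Formula.subst, Formula.Holds, ih, Term.eval_cons_lift]
  | allSet φ ih | exSet φ ih =>
    intro k l σ τ v w
    simp only [Formula.subst, Formula.Holds, ih, SetVar.idx_cons_lift]
  | _ => simp_all [Formula.subst, Formula.Holds]

@[simp] theorem Formula.holds_liftN (M : Set (Set ℕ)) {n m : ℕ} (φ : Formula n m) (a : ℕ)
    (v : Fin n → ℕ) (w : Fin m → Set ℕ) :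
    φ.liftN.Holds M (Fin.cons a v) w ↔ φ.Holds M v w := by
  simp [Formula.liftN, Formula.holds_subst, Term.eval]

@[simp] theorem Formula.holds_liftS (M : Set (Set ℕ)) {n m : ℕ} (φ : Formula n m) (A : Set ℕ)
    (v : Fin n → ℕ) (w : Fin m → Set ℕ) :
    φ.liftS.Holds M v (Fin.cons A w) ↔ φ.Holds M v w := by
  simp [Formula.liftS, Formula.holds_subst, Term.eval]

@[simp] theorem Formula.holds_inst (M : Set (Set ℕ)) {n m : ℕ} (φ : Formula (n + 1) m)
    (t : Term n) (v : Fin n → ℕ) (w : Fin m → Set ℕ) :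
    (φ.inst t).Holds M v w ↔ φ.Holds M (Fin.cons (t.eval v) v) w := by
  rw [Formula.inst, Formula.holds_subst]
  congr! 1
  funext i
  refine Fin.cases ?_ (fun i => ?_) i <;> simp [Term.eval]

@[simp] theorem Formula.holds_instSet (M : Set (Set ℕ)) {n m : ℕ} (φ : Formula n (m + 1))
    (Y : SetVar m) (v : Fin n → ℕ) (w : Fin m → Set ℕ) :
    (φ.instSet Y).Holds M v w ↔ φ.Holds M v (Fin.cons (w Y.idx) w) := by
  rw [Formula.instSet, Formula.holds_subst]
  congr! 1
  funext i
  refine Fin.cases ?_ (fun i => ?_) i <;> simp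

@[simp] theorem Formula.holds_ofSentence (M : Set (Set ℕ)) {n m : ℕ} (φ : Sentence)
    (v : Fin n → ℕ) (w : Fin m → Set ℕ) :
    (Formula.ofSentence φ : Formula n m).Holds M v w ↔ Models M φ := by
  rw [Formula.ofSentence, Formula.holds_subst, Models]
  congr!

/-- Derivations are sound for every `ω`-model. -/
theorem Derives.sound {T : Set Sentence} {M : Set (Set ℕ)} (hT : ∀ φ ∈ T, Models M φ) {n m : ℕ}
    {Γ : List (Formula n m)} {φ : Formula n m} (h : Derives T Γ φ) :
    ∀ (v : Fin n → ℕ) (w : Fin m → Set ℕ), (∀ i, w i ∈ M) → (∀ χ ∈ Γ, χ.Holds M v w) →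
      φ.Holds M v w := by
  induction h with
  | ax h => intro v w _ _; simpa using hT _ h
  | assumption h => intro v w _ hΓ; exact hΓ _ h
  | negI _ _ ih₁ ih₂ =>
    intro v w hw hΓ hφ
    refine ih₂ v w hw ?_ (ih₁ v w hw ?_) <;> exact List.forall_mem_cons.2 ⟨hφ, hΓ⟩
  | byContra _ _ ih₁ ih₂ =>
    intro v w hw hΓ
    by_contra hφ
    refine ih₂ v w hw ?_ (ih₁ v w hw ?_) <;> exact List.forall_mem_cons.2 ⟨hφ, hΓ⟩
  | andI _ _ ih₁ ih₂ => intro v w hw hΓ; exact ⟨ih₁ v w hw hΓ, ih₂ v w hw hΓ⟩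
  | andE₁ _ ih => intro v w hw hΓ; exact (ih v w hw hΓ).1
  | andE₂ _ ih => intro v w hw hΓ; exact (ih v w hw hΓ).2
  | orI₁ _ ih => intro v w hw hΓ; exact .inl (ih v w hw hΓ)
  | orI₂ _ ih => intro v w hw hΓ; exact .inr (ih v w hw hΓ)
  | orE _ _ _ ih ih₁ ih₂ =>
    intro v w hw hΓ
    exact (ih v w hw hΓ).elim (fun h => ih₁ v w hw (List.forall_mem_cons.2 ⟨h, hΓ⟩))
      fun h => ih₂ v w hw (List.forall_mem_cons.2 ⟨h, hΓ⟩)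
  | impI _ ih => intro v w hw hΓ hφ; exact ih v w hw (List.forall_mem_cons.2 ⟨hφ, hΓ⟩)
  | impE _ _ ih₁ ih₂ => intro v w hw hΓ; exact ih₁ v w hw hΓ (ih₂ v w hw hΓ)
  | iffI _ _ ih₁ ih₂ =>
    intro v w hw hΓ
    exact ⟨fun h => ih₁ v w hw (List.forall_mem_cons.2 ⟨h, hΓ⟩),
      fun h => ih₂ v w hw (List.forall_mem_cons.2 ⟨h, hΓ⟩)⟩
  | iffE₁ _ _ ih₁ ih₂ => intro v w hw hΓ; exact (ih₁ v w hw hΓ).1 (ih₂ v w hw hΓ)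
  | iffE₂ _ _ ih₁ ih₂ => intro v w hw hΓ; exact (ih₁ v w hw hΓ).2 (ih₂ v w hw hΓ)
  | allI _ ih => intro v w hw hΓ a; exact ih _ w hw (by simpa using hΓ)
  | allE t _ ih => intro v w hw hΓ; simpa using ih v w hw hΓ (t.eval v)
  | exI t _ ih => intro v w hw hΓ; exact ⟨t.eval v, by simpa using ih v w hw hΓ⟩
  | exE _ _ ih₁ ih₂ =>
    intro v w hw hΓ
    obtain ⟨a, ha⟩ := ih₁ v w hw hΓ
    simpa using ih₂ (Fin.cons a v) w hw (List.forall_mem_cons.2 ⟨ha, by simpa using hΓ⟩)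
  | allSetI _ ih =>
    intro v w hw hΓ A hA
    exact ih v _ (Fin.cases hA hw) (by simpa using hΓ)
  -- Set quantifiers range over `M` only, so instantiation needs the assignment `w` to take values
  -- in `M`.
  | allSetE Y _ ih => intro v w hw hΓ; simpa using ih v w hw hΓ _ (hw Y.idx)
  | exSetI Y _ ih => intro v w hw hΓ; exact ⟨_, hw Y.idx, by simpa using ih v w hw hΓ⟩
  | exSetE _ _ ih₁ ih₂ =>
    intro v w hw hΓ
    obtain ⟨A, hA, h⟩ := ih₁ v w hw hΓ
    simpa using ih₂ v (Fin.cons A w) (Fin.cases hA hw)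
      (List.forall_mem_cons.2 ⟨h, by simpa using hΓ⟩)
  | eqRefl t => intro v w _ _; rfl
  | eqSubst s t _ _ ih₁ ih₂ =>
    intro v w hw hΓ
    have h₁ : s.eval v = t.eval v := ih₁ v w hw hΓ
    have h₂ := ih₂ v w hw hΓ
    rw [Formula.holds_inst] at h₂ ⊢
    rwa [← h₁]

theorem Proves.models {T : Set Sentence} {M : Set (Set ℕ)} (hT : ∀ φ ∈ T, Models M φ)
    {φ : Sentence} (h : Proves T φ) : Models M φ :=
  Derives.sound hT h _ _ (fun i => i.elim0) (by simp)

/-! ### The computable sets form a model of `RCA₀` -/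

theorem Formula.holds_closeNumbers (M : Set (Set ℕ)) {n m : ℕ} (φ : Formula n m)
    (w : Fin m → Set ℕ) (h : ∀ v, φ.Holds M v w) : φ.closeNumbers.Holds M ![] w := by
  induction n with
  | zero => exact h _
  | succ n ih => exact ih (.all φ) fun v a => h _

theorem Formula.holds_closeSets (M : Set (Set ℕ)) {n m : ℕ} (φ : Formula n m) (v : Fin n → ℕ)
    (h : ∀ w : Fin m → Set ℕ, (∀ i, w i ∈ M) → φ.Holds M v w) : φ.closeSets.Holds M v ![] := by
  induction m with
  | zero => exact h _ fun i => i.elim0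
  | succ m ih => exact ih (.allSet φ) fun w hw A hA => h _ (Fin.cases hA hw)

theorem Models.closure {M : Set (Set ℕ)} {n m : ℕ} {φ : Formula n m}
    (h : ∀ v (w : Fin m → Set ℕ), (∀ i, w i ∈ M) → φ.Holds M v w) : Models M φ.closure :=
  φ.closeSets.holds_closeNumbers M _ fun v => φ.holds_closeSets M v (h v)

end SOA

/-! ### Closure properties of computable predicates -/

namespace ComputablePred

variable {α β : Type*} [Primcodable α] [Primcodable β]

theorem comp {p : β → Prop} (hp : ComputablePred p) {f : α → β} (hf : Computable f) :
    ComputablePred fun a => p (f a) := by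
  obtain ⟨g, hg, rfl⟩ := computable_iff.1 hp
  exact computable_iff.2 ⟨_, hg.comp hf, rfl⟩

protected theorem and {p q : α → Prop} (hp : ComputablePred p) (hq : ComputablePred q) :
    ComputablePred fun a => p a ∧ q a := by
  obtain ⟨f, hf, rfl⟩ := computable_iff.1 hp
  obtain ⟨g, hg, rfl⟩ := computable_iff.1 hq
  exact computable_iff.2 ⟨_, Primrec.and.to_comp.comp hf hg, by simp⟩

protected theorem or {p q : α → Prop} (hp : ComputablePred p) (hq : ComputablePred q) :
    ComputablePred fun a => p a ∨ q a :=
  (hp.not.and hq.not).not.of_eq fun a => by tauto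

protected theorem imp {p q : α → Prop} (hp : ComputablePred p) (hq : ComputablePred q) :
    ComputablePred fun a => p a → q a :=
  (hp.not.or hq).of_eq fun a => by tauto

protected theorem iff {p q : α → Prop} (hp : ComputablePred p) (hq : ComputablePred q) :
    ComputablePred fun a => p a ↔ q a :=
  ((hp.imp hq).and (hq.imp hp)).of_eq fun a => by tauto

protected theorem eq {f g : α → ℕ} (hf : Computable f) (hg : Computable g) :
    ComputablePred fun a => f a = g a :=
  comp (p := fun x : ℕ × ℕ => x.1 = x.2) Primrec.eq.computablePred (hf.pair hg)

protected theorem lt {f g : α → ℕ} (hf : Computable f) (hg : Computable g) :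
    ComputablePred fun a => f a < g a :=
  comp (p := fun x : ℕ × ℕ => x.1 < x.2) Primrec.nat_lt.computablePred (hf.pair hg)

theorem forall_lt {p : α × ℕ → Prop} (hp : ComputablePred p) {f : α → ℕ} (hf : Computable f) :
    ComputablePred fun a => ∀ x < f a, p (a, x) := by
  obtain ⟨g, hg, rfl⟩ := computable_iff.1 hp
  -- The bounded quantifier is a conjunction accumulated by primitive recursion on the bound.
  refine computable_iff.2 ⟨fun a => Nat.rec (motive := fun _ => Bool) true
    (fun y b => g (a, y) && b) (f a), ?_, ?_⟩
  · exact Computable.nat_rec hf (.const true) (Primrec.and.to_comp.comp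
      (hg.comp (Computable.fst.pair (Computable.fst.comp .snd)))
      (Computable.snd.comp .snd)).to₂
  · funext a
    beta_reduce
    rw [eq_iff_iff]
    generalize f a = N
    induction N with
    | zero => simp
    | succ N ih =>
      simp [-Order.lt_add_one_iff, Nat.lt_succ_iff_lt_or_eq, or_imp, forall_and, ih, and_comm]

theorem exists_lt {p : α × ℕ → Prop} (hp : ComputablePred p) {f : α → ℕ} (hf : Computable f) :
    ComputablePred fun a => ∃ x < f a, p (a, x) :=
  (hp.not.forall_lt hf).not.of_eq fun a => by simp

end ComputablePred

theorem Computable.nat_add {α : Type*} [Primcodable α] {f g : α → ℕ} (hf : Computable f)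
    (hg : Computable g) : Computable fun a => f a + g a :=
  Primrec.nat_add.to_comp.comp hf hg

theorem Computable.nat_mul {α : Type*} [Primcodable α] {f g : α → ℕ} (hf : Computable f)
    (hg : Computable g) : Computable fun a => f a * g a :=
  Primrec.nat_mul.to_comp.comp hf hg

/-! ### Arithmetical complexity of formulae with computable parameters -/

namespace SOA

theorem Term.computable_eval {α : Type*} [Primcodable α] {n : ℕ} {v : α → Fin n → ℕ}
    (hv : ∀ i, Computable fun a => v a i) (t : Term n) : Computable fun a => t.eval (v a) := by
  induction t with
  | var i => exact hv i
  | zero => exact .const 0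
  | one => exact .const 1
  | add s t hs ht => exact hs.nat_add ht
  | mul s t hs ht => exact hs.nat_mul ht

theorem computable_cons {α : Type*} [Primcodable α] {n : ℕ} {v : α → Fin n → ℕ}
    (hv : ∀ i, Computable fun a => v a i) (i : Fin (n + 1)) :
    Computable fun x : α × ℕ => (Fin.cons x.2 (v x.1) : Fin (n + 1) → ℕ) i := by
  refine Fin.cases ?_ (fun i => ?_) i
  · exact .snd
  · exact (hv i).comp .fst

/-- The type `α` of inputs is arbitrary so that a bounded quantifier can be handled by passing to `α
× ℕ`. There are no set quantifiers, so the choice of `M` plays no role. -/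
theorem IsBounded.computablePred (M : Set (Set ℕ)) {n m : ℕ} {φ : Formula n m} (h : IsBounded φ)
    {w : Fin m → Set ℕ} (hw : ∀ i, w i ∈ REC) :
    ∀ {α : Type} [Primcodable α] {v : α → Fin n → ℕ}, (∀ i, Computable fun a => v a i) →
      ComputablePred fun a => φ.Holds M (v a) w := by
  induction h with
  | eq s t => intro α _ v hv; exact .eq (s.computable_eval hv) (t.computable_eval hv)
  | lt s t => intro α _ v hv; exact .lt (s.computable_eval hv) (t.computable_eval hv)
  | mem t X => intro α _ v hv; exact (hw X.idx).comp (t.computable_eval hv)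
  | neg _ ih => intro α _ v hv; exact (ih hw hv).not
  | and _ _ ih₁ ih₂ => intro α _ v hv; exact (ih₁ hw hv).and (ih₂ hw hv)
  | or _ _ ih₁ ih₂ => intro α _ v hv; exact (ih₁ hw hv).or (ih₂ hw hv)
  | imp _ _ ih₁ ih₂ => intro α _ v hv; exact (ih₁ hw hv).imp (ih₂ hw hv)
  | iff _ _ ih₁ ih₂ => intro α _ v hv; exact (ih₁ hw hv).iff (ih₂ hw hv)
  | ball t _ ih =>
    intro α _ v hv
    refine ((ih hw (computable_cons hv)).forall_lt (t.computable_eval hv)).of_eq fun a => ?_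
    simp [Formula.Holds, Term.eval]
  | bex t _ ih =>
    intro α _ v hv
    refine ((ih hw (computable_cons hv)).exists_lt (t.computable_eval hv)).of_eq fun a => ?_
    simp [Formula.Holds, Term.eval]

/-- A block of existential quantifiers is contracted to a single one by coding the witnesses with
`Nat.pair`. -/
theorem IsSigma01.exists_computablePred (M : Set (Set ℕ)) {n m : ℕ} {φ : Formula n m}
    (h : IsSigma01 φ) {w : Fin m → Set ℕ} (hw : ∀ i, w i ∈ REC) :
    ∀ {α : Type} [Primcodable α] {v : α → Fin n → ℕ}, (∀ i, Computable fun a => v a i) →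
      ∃ p : α × ℕ → Prop, ComputablePred p ∧ ∀ a, φ.Holds M (v a) w ↔ ∃ k, p (a, k) := by
  induction h with
  | of h => intro α _ v hv; exact ⟨_, (h.computablePred M hw hv).comp .fst, by simp⟩
  | ex _ ih =>
    intro α _ v hv
    obtain ⟨p, hp, h⟩ := ih hw (computable_cons hv)
    refine ⟨fun x => p ((x.1, x.2.unpair.1), x.2.unpair.2), hp.comp
      ((Computable.fst.pair (Computable.fst.comp (Computable.unpair.comp .snd))).pair
        (Computable.snd.comp (Computable.unpair.comp .snd))), fun a => ?_⟩
    constructor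
    · rintro ⟨b, hb⟩
      obtain ⟨k, hk⟩ := (h (a, b)).1 hb
      exact ⟨Nat.pair b k, by simpa using hk⟩
    · rintro ⟨k, hk⟩
      exact ⟨_, (h (a, k.unpair.1)).2 ⟨_, hk⟩⟩

theorem IsPi01.exists_computablePred (M : Set (Set ℕ)) {n m : ℕ} {φ : Formula n m}
    (h : IsPi01 φ) {w : Fin m → Set ℕ} (hw : ∀ i, w i ∈ REC) :
    ∀ {α : Type} [Primcodable α] {v : α → Fin n → ℕ}, (∀ i, Computable fun a => v a i) →
      ∃ p : α × ℕ → Prop, ComputablePred p ∧ ∀ a, ¬ φ.Holds M (v a) w ↔ ∃ k, p (a, k) := by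
  induction h with
  | of h => intro α _ v hv; exact ⟨_, ((h.computablePred M hw hv).comp .fst).not, by simp⟩
  | all _ ih =>
    intro α _ v hv
    obtain ⟨p, hp, h⟩ := ih hw (computable_cons hv)
    refine ⟨fun x => p ((x.1, x.2.unpair.1), x.2.unpair.2), hp.comp
      ((Computable.fst.pair (Computable.fst.comp (Computable.unpair.comp .snd))).pair
        (Computable.snd.comp (Computable.unpair.comp .snd))), fun a => ?_⟩
    simp only [Formula.Holds, not_forall]
    constructor
    · rintro ⟨b, hb⟩
      obtain ⟨k, hk⟩ := (h (a, b)).1 hb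
      exact ⟨Nat.pair b k, by simpa using hk⟩
    · rintro ⟨k, hk⟩
      exact ⟨_, (h (a, k.unpair.1)).2 ⟨_, hk⟩⟩

/-- Post's theorem: a set that is both Σ⁰₁ and Π⁰₁ in computable parameters is computable, since one
can search simultaneously for a witness of `φ` and for a counterexample to `ψ`. -/
theorem holds_deltaComprehension {n m : ℕ} {φ ψ : Formula (n + 1) m} (hφ : IsSigma01 φ)
    (hψ : IsPi01 ψ) (v : Fin n → ℕ) {w : Fin m → Set ℕ} (hw : ∀ i, w i ∈ REC) :
    (deltaComprehension φ ψ).Holds REC v w := by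
  classical
  intro h
  have hv : ∀ i, Computable fun a : ℕ => (Fin.cons a v : Fin (n + 1) → ℕ) i :=
    Fin.cases .id fun i => .const (v i)
  obtain ⟨p, hp, hpφ⟩ := hφ.exists_computablePred REC hw hv
  obtain ⟨q, hq, hqψ⟩ := hψ.exists_computablePred REC hw hv
  have h' : ∀ a : ℕ, φ.Holds REC (Fin.cons a v) w ↔ ψ.Holds REC (Fin.cons a v) w := h
  have hex : ∀ a : ℕ, ∃ k, p (a, k) ∨ q (a, k) := fun a => by
    by_cases ha : φ.Holds REC (Fin.cons a v) w
    · exact ((hpφ a).1 ha).imp fun k => .inl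
    · exact ((hqψ a).1 fun hψ => ha ((h' a).2 hψ)).imp fun k => .inr
  -- The unbounded search stops on every input; which of `p`, `q` holds at the number found decides
  -- membership.
  have hf : Computable fun a => Nat.find (hex a) :=
    Computable.find (P := fun a k => p (a, k) ∨ q (a, k)) (hp.or hq) hex
  have hA : {a : ℕ | φ.Holds REC (Fin.cons a v) w} ∈ REC := by
    refine (hp.comp (Computable.id.pair hf)).of_eq fun a => ?_
    refine ⟨fun ha => (hpφ a).2 ⟨_, ha⟩, fun ha => ?_⟩
    rcases Nat.find_spec (hex a) with hk | hk
    · exact hk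
    · exact absurd ((h' a).1 ha) ((hqψ a).2 ⟨_, hk⟩)
  refine ⟨_, hA, fun a => ?_⟩
  simp [Formula.Holds, Term.eval]

/-- The number quantifiers range over the standard numbers, so induction holds for all formulae, Σ⁰₁
or not. -/
theorem holds_inductionAxiom (M : Set (Set ℕ)) {n m : ℕ} (φ : Formula (n + 1) m) (v : Fin n → ℕ)
    (w : Fin m → Set ℕ) : (inductionAxiom φ).Holds M v w := by
  rintro ⟨h₀, h₁⟩ a
  have h : ∀ a : ℕ, φ.Holds M (Fin.cons a v) w → φ.Holds M (Fin.cons (a + 1) v) w := by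
    intro a ha
    have := (Formula.holds_subst M _ _ _ _ _).1 (h₁ a ha)
    convert this using 1
    funext i
    refine Fin.cases ?_ (fun i => ?_) i <;> simp [Term.eval]
  induction a with
  | zero => simpa [Term.eval] using h₀
  | succ a ih => exact h a ih

theorem models_basicAxioms (M : Set (Set ℕ)) : ∀ φ ∈ basicAxioms, Models M φ := by
  simp only [basicAxioms, Set.mem_insert_iff, Set.mem_singleton_iff, forall_eq_or_imp, forall_eq]
  simp only [Models, allN, Formula.Holds, Term.eval, Term.eval_lift, Fin.cons_zero]
  refine ⟨?_, ?_, ?_, ?_, ?_, ?_, ?_, ?_⟩ <;> intros <;> first | omega | ring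

/-- The computable sets form an `ω`-model of `RCA₀`. -/
theorem models_RCA0 : ∀ φ ∈ RCA0, Models REC φ := by
  rintro φ ((h | ⟨n, m, φ, -, rfl⟩) | ⟨n, m, φ, ψ, hφ, hψ, rfl⟩)
  · exact models_basicAxioms REC φ h
  · exact .closure fun v w _ => holds_inductionAxiom REC φ v w
  · exact .closure fun v w hw => holds_deltaComprehension hφ hψ v hw

end SOA

namespace SOA

/-! ### Computable functions with rational values -/

/-- The first component of a pair coded by `natPair`. -/
def natFst (z : ℕ) : ℕ := z - z.sqrt * z.sqrt

/-- The second component of a pair coded by `natPair`. -/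
def natSnd (z : ℕ) : ℕ := z.sqrt - natFst z

/-- The code lies between (a + b)² and (a + b)² + 2(a + b), hence below the next square. This makes
the pairing injective and computably invertible on its range. -/
theorem sqrt_natPair (a b : ℕ) : (natPair a b).sqrt = a + b :=
  Nat.sqrt_add_eq _ (by omega)

@[simp] theorem natFst_natPair (a b : ℕ) : natFst (natPair a b) = a := by
  rw [natFst, sqrt_natPair, natPair, Nat.add_sub_cancel_left]

@[simp] theorem natSnd_natPair (a b : ℕ) : natSnd (natPair a b) = b := by
  simp [natSnd, sqrt_natPair]

@[simp] theorem natPair_inj {a b c d : ℕ} : natPair a b = natPair c d ↔ a = c ∧ b = d :=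
  ⟨fun h => ⟨by simpa using congrArg natFst h, by simpa using congrArg natSnd h⟩,
    fun h => h.1 ▸ h.2 ▸ rfl⟩

variable {α β : Type*} [Primcodable α] [Primcodable β]

theorem _root_.Computable.nat_sub {f g : α → ℕ} (hf : Computable f)
    (hg : Computable g) : Computable fun a => f a - g a :=
  Primrec.nat_sub.to_comp.comp hf hg

theorem _root_.Computable.nat_div {f g : α → ℕ} (hf : Computable f)
    (hg : Computable g) : Computable fun a => f a / g a :=
  Primrec.nat_div.to_comp.comp hf hg

theorem _root_.Computable.natPair {f g : α → ℕ} (hf : Computable f) (hg : Computable g) :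
    Computable fun a => natPair (f a) (g a) :=
  ((hf.nat_add hg).nat_mul (hf.nat_add hg)).nat_add hf

theorem computable_natFst : Computable natFst :=
  have h : Computable Nat.sqrt := Primrec.nat_sqrt.to_comp
  Computable.id.nat_sub (h.nat_mul h)

theorem computable_natSnd : Computable natSnd :=
  have h : Computable Nat.sqrt := Primrec.nat_sqrt.to_comp
  h.nat_sub computable_natFst

theorem computable_two_pow : Computable fun n : ℕ => 2 ^ n :=
  (Computable.nat_rec .id (.const 1)
    ((Computable.const 2).nat_mul (Computable.snd.comp .snd)).to₂).of_eq fun n => by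
      induction n with
      | zero => rfl
      | succ n ih => rw [pow_succ', ← ih]; rfl

/-- A function with rational values is computable if it is given by a fraction with computable
numerator and denominator. -/
def QComputable (f : α → ℚ) : Prop :=
  ∃ a b d : α → ℕ, Computable a ∧ Computable b ∧ Computable d ∧
    ∀ x, 0 < d x ∧ f x = ((a x : ℚ) - b x) / d x

namespace QComputable

variable {f g : α → ℚ}

theorem of_eq (hf : QComputable f) (h : ∀ x, f x = g x) : QComputable g :=
  funext h ▸ hf

theorem comp {f : β → ℚ} (hf : QComputable f) {h : α → β} (hh : Computable h) :
    QComputable fun x => f (h x) := by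
  obtain ⟨a, b, d, ha, hb, hd, H⟩ := hf
  exact ⟨_, _, _, ha.comp hh, hb.comp hh, hd.comp hh, fun x => H _⟩

theorem const (q : ℚ) : QComputable fun _ : α => q := by
  refine ⟨_, _, _, .const q.num.toNat, .const (-q.num).toNat, .const q.den, fun x => ⟨q.pos, ?_⟩⟩
  have h : (q.num.toNat : ℚ) - (-q.num).toNat = q.num := mod_cast Int.toNat_sub_toNat_neg q.num
  rw [h, Rat.num_div_den]

theorem half_pow {h : α → ℕ} (hh : Computable h) : QComputable fun x => (1 / 2 : ℚ) ^ h x :=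
  ⟨_, _, _, .const 1, .const 0, computable_two_pow.comp hh, fun x => by simp⟩

theorem add (hf : QComputable f) (hg : QComputable g) : QComputable fun x => f x + g x := by
  obtain ⟨a, b, d, ha, hb, hd, H⟩ := hf
  obtain ⟨a', b', d', ha', hb', hd', H'⟩ := hg
  refine ⟨_, _, _, (ha.nat_mul hd').nat_add (ha'.nat_mul hd),
    (hb.nat_mul hd').nat_add (hb'.nat_mul hd), hd.nat_mul hd', fun x => ?_⟩
  have h := (H x).1
  have h' := (H' x).1
  refine ⟨Nat.mul_pos h h', ?_⟩
  beta_reduce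
  rw [(H x).2, (H' x).2]
  push_cast
  field_simp
  ring

theorem mul (hf : QComputable f) (hg : QComputable g) : QComputable fun x => f x * g x := by
  obtain ⟨a, b, d, ha, hb, hd, H⟩ := hf
  obtain ⟨a', b', d', ha', hb', hd', H'⟩ := hg
  refine ⟨_, _, _, (ha.nat_mul ha').nat_add (hb.nat_mul hb'),
    (ha.nat_mul hb').nat_add (hb.nat_mul ha'), hd.nat_mul hd', fun x => ?_⟩
  have h := (H x).1
  have h' := (H' x).1
  refine ⟨Nat.mul_pos h h', ?_⟩
  beta_reduce
  rw [(H x).2, (H' x).2]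
  push_cast
  field_simp
  ring

theorem sub (hf : QComputable f) (hg : QComputable g) : QComputable fun x => f x - g x :=
  (hf.add ((const (-1)).mul hg)).of_eq fun x => by ring

theorem lt (hf : QComputable f) (hg : QComputable g) : ComputablePred fun x => f x < g x := by
  obtain ⟨a, b, d, ha, hb, hd, H⟩ := hf
  obtain ⟨a', b', d', ha', hb', hd', H'⟩ := hg
  refine (ComputablePred.lt ((ha.nat_mul hd').nat_add (hb'.nat_mul hd))
    ((ha'.nat_mul hd).nat_add (hb.nat_mul hd'))).of_eq fun x => ?_
  have h : (0 : ℚ) < d x := mod_cast (H x).1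
  have h' : (0 : ℚ) < d' x := mod_cast (H' x).1
  rw [(H x).2, (H' x).2, div_lt_div_iff₀ h h', ← Nat.cast_lt (α := ℚ)]
  push_cast
  constructor <;> intro <;> linarith

theorem ite {p : α → Prop} [DecidablePred p] (hp : ComputablePred p) (hf : QComputable f)
    (hg : QComputable g) : QComputable fun x => if p x then f x else g x := by
  obtain ⟨a, b, d, ha, hb, hd, H⟩ := hf
  obtain ⟨a', b', d', ha', hb', hd', H'⟩ := hg
  refine ⟨_, _, _, hp.decide.cond ha ha', hp.decide.cond hb hb', hp.decide.cond hd hd',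
    fun x => ?_⟩
  by_cases h : p x <;> simp [h, H x, H' x]

theorem max (hf : QComputable f) (hg : QComputable g) : QComputable fun x => max (f x) (g x) :=
  (ite (hf.lt hg) hg hf).of_eq fun x => by
    split_ifs with h
    · exact (max_eq_right h.le).symm
    · exact (max_eq_left (not_lt.1 h)).symm

theorem min (hf : QComputable f) (hg : QComputable g) : QComputable fun x => min (f x) (g x) :=
  (ite (hf.lt hg) hf hg).of_eq fun x => by
    split_ifs with h
    · exact (min_eq_left h.le).symm
    · exact (min_eq_right (not_lt.1 h)).symm

theorem sum {f : α × ℕ → ℚ} (hf : QComputable f) {N : α → ℕ} (hN : Computable N) :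
    QComputable fun x => ∑ k ∈ Finset.range (N x), f (x, k) := by
  obtain ⟨a, b, d, ha, hb, hd, H⟩ := hf
  -- The recursion carries the positive part, the negative part and the denominator of the partial
  -- sum, starting from 0/1.
  let T : α → ℕ → ℕ × ℕ × ℕ := fun x n => Nat.rec (motive := fun _ => ℕ × ℕ × ℕ) (0, 0, 1)
    (fun k t => (t.1 * d (x, k) + a (x, k) * t.2.2, t.2.1 * d (x, k) + b (x, k) * t.2.2,
      t.2.2 * d (x, k))) n
  have hT : Computable fun x => T x (N x) := by
    refine Computable.nat_rec (h := fun x y => (y.2.1 * d (x, y.1) + a (x, y.1) * y.2.2.2,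
      y.2.2.1 * d (x, y.1) + b (x, y.1) * y.2.2.2, y.2.2.2 * d (x, y.1))) hN (.const (0, 0, 1)) ?_
    have hxk : Computable fun y : α × ℕ × ℕ × ℕ × ℕ => (y.1, y.2.1) :=
      Computable.fst.pair (Computable.fst.comp .snd)
    have ht : Computable fun y : α × ℕ × ℕ × ℕ × ℕ => y.2.2 := Computable.snd.comp .snd
    have h1 := Computable.fst.comp ht
    have h2 := Computable.fst.comp (Computable.snd.comp ht)
    have h3 := Computable.snd.comp (Computable.snd.comp ht)
    exact (((h1.nat_mul (hd.comp hxk)).nat_add ((ha.comp hxk).nat_mul h3)).pair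
      (((h2.nat_mul (hd.comp hxk)).nat_add ((hb.comp hxk).nat_mul h3)).pair
        (h3.nat_mul (hd.comp hxk)))).to₂
  refine ⟨_, _, _, Computable.fst.comp hT, Computable.fst.comp (Computable.snd.comp hT),
    Computable.snd.comp (Computable.snd.comp hT), fun x => ?_⟩
  beta_reduce
  generalize N x = n
  induction n with
  | zero => simp [T]
  | succ n ih =>
    obtain ⟨h, ih⟩ := ih
    obtain ⟨h', e⟩ := H (x, n)
    refine ⟨Nat.mul_pos h h', ?_⟩
    rw [Finset.sum_range_succ, ih, e]
    change _ = (((T x n).1 * d (x, n) + a (x, n) * (T x n).2.2 : ℕ) -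
      ((T x n).2.1 * d (x, n) + b (x, n) * (T x n).2.2 : ℕ) : ℚ) / ((T x n).2.2 * d (x, n) : ℕ)
    push_cast
    field_simp
    ring

theorem floor_inv (hf : QComputable f) : Computable fun x => ⌊(f x)⁻¹⌋₊ := by
  obtain ⟨a, b, d, ha, hb, hd, H⟩ := hf
  refine (hd.nat_div (ha.nat_sub hb)).of_eq fun x => ?_
  rw [(H x).2, inv_div]
  -- When `f x ≤ 0`, truncated subtraction and division by zero give 0, which is also the floor of
  -- the nonpositive inverse.
  rcases le_total (b x) (a x) with h | h
  · rw [← Nat.cast_sub h, Nat.floor_div_eq_div]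
  · rw [Nat.sub_eq_zero_of_le h, Nat.div_zero, eq_comm, Nat.floor_eq_zero]
    refine lt_of_le_of_lt (div_nonpos_of_nonneg_of_nonpos (by positivity) ?_) one_pos
    simpa using h

end QComputable

theorem toNat_mul_natCast (m : ℤ) (k : ℕ) : (m * k).toNat = m.toNat * k := by
  rcases le_total 0 m with h | h
  · rw [Int.toNat_mul h (by positivity), Int.toNat_natCast]
  · rw [Int.toNat_of_nonpos h, zero_mul,
      Int.toNat_of_nonpos (mul_nonpos_of_nonpos_of_nonneg h (by positivity))]

/-- Positive and negative parts are compatible with multiplication by a natural number. The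
differences in the conclusion are truncated, those in `h` are integers. -/
theorem toNat_mul_eq {n : ℤ} {a b d e : ℕ} (h : n * d = (a - b) * e) :
    n.toNat * d = (a - b) * e ∧ (-n).toNat * d = (b - a) * e := by
  rw [← toNat_mul_natCast, ← toNat_mul_natCast, neg_mul, h, ← neg_mul, neg_sub,
    toNat_mul_natCast, toNat_mul_natCast, Int.toNat_sub, Int.toNat_sub]
  exact ⟨rfl, rfl⟩

/-- The code refers to lowest terms, whereas `QComputable` supplies an arbitrary fraction; so the
fraction has to be reduced effectively. Once the reduced denominator is known, `key` gives the two
parts of the numerator by exact division. -/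
theorem QComputable.ratCode {f : α → ℚ} (hf : QComputable f) : Computable fun x => ratCode (f x) := by
  classical
  obtain ⟨a, b, d, ha, hb, hd, H⟩ := hf
  have key : ∀ x, (f x).num.toNat * d x = (a x - b x) * (f x).den ∧
      (-(f x).num).toNat * d x = (b x - a x) * (f x).den := fun x => by
    refine toNat_mul_eq ?_
    have h : (d x : ℚ) ≠ 0 := mod_cast (H x).1.ne'
    have h' : ((f x).den : ℚ) ≠ 0 := mod_cast (f x).den_ne_zero
    have e := (H x).2
    rw [← Rat.num_div_den (f x), div_eq_div_iff h' h] at e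
    exact_mod_cast e
  -- The reduced denominator is the least positive `n` for which `n * f x` is an integer. One of the
  -- truncated differences vanishes, so integrality is divisibility of both multiples by `d x`.
  have hden : Computable fun x => (f x).den := by
    have hex : ∀ x, ∃ n, 0 < n ∧ (n * (a x - b x)) % d x = 0 ∧ (n * (b x - a x)) % d x = 0 :=
      fun x => ⟨(f x).den, (f x).pos, Nat.mod_eq_zero_of_dvd ⟨(f x).num.toNat, by
        rw [mul_comm, ← (key x).1, mul_comm]⟩, Nat.mod_eq_zero_of_dvd ⟨(-(f x).num).toNat, by
        rw [mul_comm, ← (key x).2, mul_comm]⟩⟩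
    have hmod : ∀ {u v : α → ℕ}, Computable u → Computable v →
        ComputablePred fun x : α × ℕ => (x.2 * (u x.1 - v x.1)) % d x.1 = 0 := fun hu hv =>
      .eq (Primrec.nat_mod.to_comp.comp (Computable.snd.nat_mul
        ((hu.comp .fst).nat_sub (hv.comp .fst))) (hd.comp .fst)) (.const 0)
    refine (Computable.find (P := fun x n => 0 < n ∧ (n * (a x - b x)) % d x = 0 ∧
      (n * (b x - a x)) % d x = 0) ((ComputablePred.lt (.const 0) .snd).and
        ((hmod ha hb).and (hmod hb ha))) hex).of_eq fun x => ?_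
    refine le_antisymm (Nat.find_min' _ ?_) ?_
    · exact ⟨(f x).pos, Nat.mod_eq_zero_of_dvd ⟨(f x).num.toNat, by
        rw [mul_comm, ← (key x).1, mul_comm]⟩, Nat.mod_eq_zero_of_dvd ⟨(-(f x).num).toNat, by
        rw [mul_comm, ← (key x).2, mul_comm]⟩⟩
    · obtain ⟨h0, h1, h2⟩ := Nat.find_spec (hex x)
      generalize Nat.find (hex x) = n at h0 h1 h2
      obtain ⟨u, hu⟩ := Nat.dvd_of_mod_eq_zero h1
      obtain ⟨v, hv⟩ := Nat.dvd_of_mod_eq_zero h2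
      have hab : ((a x : ℚ) - b x) = ((a x - b x : ℕ) : ℚ) - (b x - a x : ℕ) := by
        rcases le_total (a x) (b x) with h | h <;> simp [h, Nat.cast_sub]
      have hd' : (d x : ℚ) ≠ 0 := mod_cast (H x).1.ne'
      have hn' : (n : ℚ) ≠ 0 := mod_cast h0.ne'
      have e : f x = ((u - v : ℤ) : ℚ) / ((n : ℤ) : ℚ) := by
        rw [(H x).2, hab]
        have hu' : (n : ℚ) * (a x - b x : ℕ) = d x * u := mod_cast hu
        have hv' : (n : ℚ) * (b x - a x : ℕ) = d x * v := mod_cast hv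
        push_cast
        rw [div_eq_div_iff hd' hn']
        linarith
      have hdvd := Rat.den_dvd (u - v : ℤ) n
      rw [Rat.divInt_eq_div, ← e] at hdvd
      exact Nat.le_of_dvd h0 (mod_cast hdvd)
  refine Computable.natPair (Computable.natPair
    ((((ha.nat_sub hb).nat_mul hden).nat_div hd).of_eq fun x => ?_)
    ((((hb.nat_sub ha).nat_mul hden).nat_div hd).of_eq fun x => ?_)) (hden.natPair (.const 0))
  · rw [← (key x).1, Nat.mul_div_cancel _ (H x).1]
  · rw [← (key x).2, Nat.mul_div_cancel _ (H x).1]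

/-- The rational number with a given code. -/
def decodeQ (z : ℕ) : ℚ :=
  ((natFst (natFst z) : ℚ) - natSnd (natFst z)) / (max 1 (natFst (natSnd z)) : ℕ)

@[simp] theorem toNat_sub_div_den (q : ℚ) : ((q.num.toNat : ℚ) - (-q.num).toNat) / q.den = q := by
  have h : (q.num.toNat : ℚ) - (-q.num).toNat = q.num := mod_cast Int.toNat_sub_toNat_neg q.num
  rw [h, Rat.num_div_den]

@[simp] theorem decodeQ_ratCode (q : ℚ) : decodeQ (ratCode q) = q := by
  rw [decodeQ, ratCode, natFst_natPair, natSnd_natPair, natFst_natPair, natSnd_natPair,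
    natFst_natPair, max_eq_right (Nat.one_le_iff_ne_zero.2 q.den_ne_zero), toNat_sub_div_den]

theorem ratCode_injective : Function.Injective ratCode :=
  Function.LeftInverse.injective decodeQ_ratCode

theorem qcomputable_decodeQ : QComputable decodeQ :=
  ⟨_, _, _, computable_natFst.comp computable_natFst, computable_natSnd.comp computable_natFst,
    Primrec.nat_max.to_comp.comp (.const 1) (computable_natFst.comp computable_natSnd),
    fun z => ⟨by positivity, rfl⟩⟩

theorem qcomputable_iff {f : α → ℚ} : QComputable f ↔ Computable fun x => ratCode (f x) :=
  ⟨QComputable.ratCode, fun h => (qcomputable_decodeQ.comp h).of_eq fun x => by simp⟩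

end SOA

namespace SOA

/-! ### Sums of spikes -/

theorem spike_nonneg (p q : ℚ) (x : ℝ) : 0 ≤ spike p q x := le_max_left _ _

theorem spike_le_half (p q : ℚ) (x : ℝ) : spike p q x ≤ 1 / 2 :=
  max_le (by norm_num) (min_le_left _ _)

theorem spike_pos_iff {p q : ℚ} {x : ℝ} : 0 < spike p q x ↔ x ∈ Set.Ioo (p : ℝ) q := by
  simp [spike]

/-- Taking maxima and minima does not increase Lipschitz constants, and the pieces have slope 0 or
±1. -/
theorem abs_spike_sub_le (p q : ℚ) (x y : ℝ) : |spike p q x - spike p q y| ≤ |x - y| := by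
  refine (abs_max_sub_max_le_max _ _ _ _).trans (max_le (by simp) ?_)
  refine (abs_min_sub_min_le_max _ _ _ _).trans (max_le (by simp) ?_)
  refine (abs_min_sub_min_le_max _ _ _ _).trans (max_le (by simp) ?_)
  rw [sub_sub_sub_cancel_left, abs_sub_comm]

/-- The partial sums of `spikeSum`, at rational numbers. -/
def spikePartialSum (ψ : ℕ → ℚ × ℚ) (m : ℕ) (x : ℚ) : ℚ :=
  ∑ k ∈ Finset.range m, (1 / 2) ^ (k + 2) * max 0 (min (1 / 2) (min (x - (ψ k).1) ((ψ k).2 - x)))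

theorem sum_half_pow (m : ℕ) :
    ∑ k ∈ Finset.range m, (1 / 2 : ℝ) ^ (k + 2) = 1 / 2 - (1 / 2) ^ (m + 1) := by
  induction m with
  | zero => norm_num
  | succ m ih => rw [Finset.sum_range_succ, ih]; ring

section

variable (ψ : ℕ → ℚ × ℚ)

theorem cast_spikePartialSum (m : ℕ) (x : ℚ) : (spikePartialSum ψ m x : ℝ) =
    ∑ k ∈ Finset.range m, (1 / 2) ^ (k + 2) * spike (ψ k).1 (ψ k).2 x := by
  simp [spikePartialSum, spike]

theorem summable_spike (x : ℝ) :
    Summable fun k => (1 / 2 : ℝ) ^ (k + 2) * spike (ψ k).1 (ψ k).2 x := by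
  refine Summable.of_nonneg_of_le (fun k => mul_nonneg (by positivity) (spike_nonneg _ _ _))
    (fun k => mul_le_mul_of_nonneg_left (spike_le_half _ _ _) (by positivity)) ?_
  exact (summable_geometric_two.comp_injective (add_left_injective 2)).mul_right _

/-- The constant is the bound 1/2 for the sum of the weights, each spike having Lipschitz constant
1. -/
theorem abs_sum_spike_sub_le (m : ℕ) (x y : ℝ) :
    |∑ k ∈ Finset.range m, (1 / 2) ^ (k + 2) * spike (ψ k).1 (ψ k).2 x -
      ∑ k ∈ Finset.range m, (1 / 2) ^ (k + 2) * spike (ψ k).1 (ψ k).2 y| ≤ 1 / 2 * |x - y| := by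
  rw [← Finset.sum_sub_distrib]
  calc _ ≤ ∑ k ∈ Finset.range m, (1 / 2 : ℝ) ^ (k + 2) * |x - y| := by
        refine (Finset.abs_sum_le_sum_abs _ _).trans (Finset.sum_le_sum fun k _ => ?_)
        rw [← mul_sub, abs_mul, abs_of_nonneg (by positivity : (0 : ℝ) ≤ (1 / 2) ^ (k + 2))]
        exact mul_le_mul_of_nonneg_left (abs_spike_sub_le _ _ _ _) (by positivity)
    _ ≤ 1 / 2 * |x - y| := by
        rw [← Finset.sum_mul, sum_half_pow]
        exact mul_le_mul_of_nonneg_right (by simp) (abs_nonneg _)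

/-- `spikeSum ψ` has the Lipschitz constant `1 / 2`. -/
theorem abs_spikeSum_sub_le_half (x y : ℝ) :
    |spikeSum ψ x - spikeSum ψ y| ≤ 1 / 2 * |x - y| :=
  le_of_tendsto (((summable_spike ψ x).hasSum.tendsto_sum_nat.sub
    (summable_spike ψ y).hasSum.tendsto_sum_nat).abs)
    (.of_forall fun m => abs_sum_spike_sub_le ψ m x y)

theorem abs_spikeSum_sub_le (x y : ℝ) : |spikeSum ψ x - spikeSum ψ y| ≤ |x - y| :=
  (abs_spikeSum_sub_le_half ψ x y).trans (by linarith [abs_nonneg (x - y)])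

theorem spikeSum_nonneg (x : ℝ) : 0 ≤ spikeSum ψ x :=
  tsum_nonneg fun _ => mul_nonneg (by positivity) (spike_nonneg _ _ _)

theorem spikeSum_pos_iff {x : ℝ} (hx : x ∈ Set.Icc (0 : ℝ) 1) :
    0 < spikeSum ψ x ↔ x ∉ piClass ψ := by
  have h : x ∉ piClass ψ ↔ ∃ k, 0 < spike (ψ k).1 (ψ k).2 x := by
    simp only [spike_pos_iff, piClass, Set.mem_sdiff, hx, true_and, not_not, Set.mem_iUnion]
  rw [h]
  constructor
  · intro h0
    by_contra! hk
    refine h0.ne' ?_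
    have : ∀ k, (1 / 2 : ℝ) ^ (k + 2) * spike (ψ k).1 (ψ k).2 x = 0 := fun k => by
      rw [le_antisymm (hk k) (spike_nonneg _ _ _), mul_zero]
    simp only [spikeSum, this, tsum_zero]
  · rintro ⟨k, hk⟩
    exact (summable_spike ψ x).tsum_pos
      (fun _ => mul_nonneg (by positivity) (spike_nonneg _ _ _)) k (by positivity)

theorem spikePartialSum_le (m : ℕ) (x : ℚ) : (spikePartialSum ψ m x : ℝ) ≤ spikeSum ψ x := by
  rw [cast_spikePartialSum]
  exact (summable_spike ψ x).sum_le_tsum _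
    fun _ _ => mul_nonneg (by positivity) (spike_nonneg _ _ _)

/-- The neglected terms with `k ≥ m` are at most 2^-(k+3), since spikes are cut off at 1/2; these
bounds add up to 2^-(m+2). -/
theorem spikeSum_le (m : ℕ) (x : ℚ) :
    spikeSum ψ x ≤ spikePartialSum ψ m x + (1 / 2 : ℝ) ^ (m + 2) := by
  rw [cast_spikePartialSum, spikeSum, ← (summable_spike ψ x).sum_add_tsum_nat_add m]
  have h : HasSum (fun k : ℕ => (1 / 2 : ℝ) ^ (m + 3) * (1 / 2) ^ k) ((1 / 2) ^ (m + 3) * 2) :=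
    hasSum_geometric_two.mul_left _
  refine add_le_add_right (((summable_nat_add_iff m).2 (summable_spike ψ x)).tsum_le_of_sum_le
    fun s => ?_) _
  refine le_trans (Finset.sum_le_sum (g := fun k => (1 / 2 : ℝ) ^ (m + 3) * (1 / 2) ^ k)
    fun k _ => ?_) ((sum_le_hasSum s (fun k _ => by positivity) h).trans_eq (by ring))
  refine (mul_le_mul_of_nonneg_left (spike_le_half _ _ _) (by positivity)).trans_eq ?_
  ring

theorem spikePartialSum_mono {m m' : ℕ} (h : m ≤ m') (x : ℚ) :
    spikePartialSum ψ m x ≤ spikePartialSum ψ m' x :=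
  Finset.sum_le_sum_of_subset_of_nonneg (Finset.range_mono h)
    fun _ _ _ => mul_nonneg (by positivity) (le_max_left _ _)

/-- Each further term is at most the amount by which the error bound drops. Together with
`spikePartialSum_mono`, this makes the rational enclosures of the sum nested in the stage. -/
theorem spikePartialSum_add_antitone {m m' : ℕ} (h : m ≤ m') (x : ℚ) :
    spikePartialSum ψ m' x + (1 / 2) ^ (m' + 2) ≤ spikePartialSum ψ m x + (1 / 2) ^ (m + 2) := by
  refine antitone_nat_of_succ_le (f := fun m => spikePartialSum ψ m x + (1 / 2) ^ (m + 2))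
    (fun n => ?_) h
  have h1 : max 0 (min (1 / 2) (min (x - (ψ n).1) ((ψ n).2 - x))) ≤ 1 / 2 :=
    max_le (by norm_num) (min_le_left _ _)
  have h2 := mul_le_mul_of_nonneg_left h1 (by positivity : (0 : ℚ) ≤ (1 / 2) ^ (n + 2))
  have h3 : (1 / 2 : ℚ) ^ (n + 1 + 2) = (1 / 2) ^ (n + 2) * (1 / 2) := by ring
  rw [spikePartialSum, Finset.sum_range_succ, ← spikePartialSum, h3]
  linarith

theorem abs_spikePartialSum_sub_le (m : ℕ) (x y : ℚ) :
    |spikePartialSum ψ m x - spikePartialSum ψ m y| ≤ |x - y| := by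
  have h := abs_sum_spike_sub_le ψ m x y
  rw [← cast_spikePartialSum, ← cast_spikePartialSum] at h
  have : (|spikePartialSum ψ m x - spikePartialSum ψ m y| : ℝ) ≤ |(x : ℝ) - y| :=
    h.trans (by linarith [abs_nonneg ((x : ℝ) - y)])
  exact_mod_cast this

theorem qcomputable_spikePartialSum {ψ : ℕ → ℚ × ℚ} (h₁ : QComputable fun k => (ψ k).1)
    (h₂ : QComputable fun k => (ψ k).2) {α : Type*} [Primcodable α] {m : α → ℕ} {x : α → ℚ}
    (hm : Computable m) (hx : QComputable x) :
    QComputable fun a => spikePartialSum ψ (m a) (x a) := by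
  refine QComputable.sum (f := fun z : α × ℕ => (1 / 2) ^ (z.2 + 2) *
    max 0 (min (1 / 2) (min (x z.1 - (ψ z.2).1) ((ψ z.2).2 - x z.1)))) ?_ hm
  have hx' := hx.comp (Computable.fst (α := α) (β := ℕ))
  exact (QComputable.half_pow (Computable.snd.nat_add (.const 2))).mul
    ((QComputable.const 0).max ((QComputable.const _).min ((hx'.sub (h₁.comp .snd)).min
      ((h₂.comp .snd).sub hx'))))

/-- If `piClass ψ` is nonempty, then no `spikeSum ψ`-fine partition has all of its tags where
`spikeSum ψ` is positive. -/
theorem not_hasFinePartition (hK : (piClass ψ).Nonempty) {ℓ : ℕ} {x t : ℕ → ℝ} (h0 : x 0 = 0)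
    (h1 : x ℓ = 1) (hxt : ∀ j < ℓ, x j < t j ∧ t j < x (j + 1))
    (ht : ∀ j < ℓ, 0 < spikeSum ψ (t j))
    (hf : ∀ j < ℓ, t j - spikeSum ψ (t j) ≤ x j ∧ x (j + 1) ≤ t j + spikeSum ψ (t j)) : False := by
  obtain ⟨y, hy⟩ := hK
  have hy0 : spikeSum ψ y = 0 :=
    le_antisymm (not_lt.1 fun h => (spikeSum_pos_iff ψ hy.1).1 h hy) (spikeSum_nonneg ψ y)
  -- Otherwise `x j ≤ y` propagates from `x 0 = 0` to the right end and yields `1 < y`.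
  have hex : ∃ j < ℓ, x j ≤ y ∧ y ≤ x (j + 1) := by
    by_contra! hc
    have : ∀ j ≤ ℓ, x j ≤ y := by
      intro j hj
      induction j with
      | zero => exact h0 ▸ hy.1.1
      | succ j ih => exact (hc j hj (ih (by omega))).le
    rcases Nat.eq_zero_or_pos ℓ with rfl | hℓ
    · linarith
    · have := hc (ℓ - 1) (by omega) (this _ (by omega))
      rw [Nat.sub_add_cancel hℓ, h1] at this
      exact absurd hy.1.2 (not_le.2 this)
  obtain ⟨j, hj, hj1, hj2⟩ := hex
  have h2 : |t j - y| ≤ spikeSum ψ (t j) :=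
    abs_le.2 ⟨by linarith [(hf j hj).2], by linarith [(hf j hj).1]⟩
  -- Since the sum vanishes at `y`, its value at `t j` is at most half of `|t j - y|`, hence at most
  -- half of itself.
  have h3 := (le_abs_self _).trans (abs_spikeSum_sub_le_half ψ (t j) y)
  linarith [ht j hj]

end

/-! ### A singular cover of the computable reals -/

open Nat.Partrec (Code)

/-- The output of the `e`-th program at input `e + 4`, if it appears within `s` steps, where
`n` codes the pair of `e` and `s`. -/
def coverOutput (n : ℕ) : Option ℕ :=
  Code.evaln n.unpair.2 (Denumerable.ofNat Code n.unpair.1) (n.unpair.1 + 4)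

/-- Without an output the centre is a junk value; the radius is then 0 and the open interval is
empty. -/
def coverCenter (n : ℕ) : ℚ := decodeQ ((coverOutput n).getD 0)

def coverRadius (n : ℕ) : ℚ := if (coverOutput n).isSome then (1 / 2) ^ (n.unpair.1 + 3) else 0

/-- A computable sequence of intervals that covers the computable reals. -/
def cover (n : ℕ) : ℚ × ℚ := (coverCenter n - coverRadius n, coverCenter n + coverRadius n)

theorem computable_coverOutput : Computable coverOutput :=
  Code.primrec_evaln.to_comp.comp (((Computable.snd.comp .unpair).pair
    ((Computable.ofNat Code).comp (Computable.fst.comp .unpair))).pair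
      ((Computable.fst.comp .unpair).nat_add (.const 4)))

theorem qcomputable_coverCenter : QComputable coverCenter :=
  qcomputable_decodeQ.comp (Computable.option_getD computable_coverOutput (.const 0))

theorem qcomputable_coverRadius : QComputable coverRadius :=
  .ite (Computable.computablePred ((Primrec.option_isSome.to_comp.comp
    computable_coverOutput).of_eq fun n => by simp))
    (.half_pow ((Computable.fst.comp .unpair).nat_add (.const 3))) (.const 0)

/-- If program `e` computes a fast sequence for `x`, its term with index `e + 4` is within 2^-(e+4)
of `x`, strictly less than the radius 2^-(e+3) of the interval around that term. -/
theorem exists_mem_cover {x : ℝ} (hx : IsComputableReal x) :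
    ∃ n, x ∈ Set.Ioo ((cover n).1 : ℝ) (cover n).2 := by
  obtain ⟨q, hq, hc, hlim⟩ := hx
  obtain ⟨c, hcode⟩ := Code.exists_code.1 (Partrec.nat_iff.1 hq.partrec)
  have hmem : ratCode (q (Encodable.encode c + 4)) ∈ c.eval (Encodable.encode c + 4) := by
    rw [hcode]; simp
  obtain ⟨s, hs⟩ := Code.evaln_complete.1 hmem
  refine ⟨Nat.pair (Encodable.encode c) s, ?_⟩
  have ho : coverOutput (Nat.pair (Encodable.encode c) s) =
      some (ratCode (q (Encodable.encode c + 4))) := by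
    simpa [coverOutput] using hs
  generalize hi : Encodable.encode c = i at *
  have hd : |(q (i + 4) : ℝ) - x| ≤ (1 / 2) ^ (i + 4) := by
    refine le_of_tendsto ((tendsto_const_nhds.sub hlim).abs)
      (Filter.eventually_atTop.2 ⟨i + 4, fun j hj => ?_⟩)
    have := hc (i + 4) j hj
    have := (Rat.cast_le (K := ℝ)).2 this
    push_cast at this
    exact this
  have hlt : (1 / 2 : ℝ) ^ (i + 4) < (1 / 2) ^ (i + 3) :=
    pow_lt_pow_right_of_lt_one₀ (by norm_num) (by norm_num) (by omega)
  have := abs_lt.1 (hd.trans_lt hlt)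
  simp only [cover, coverCenter, coverRadius, ho, Option.isSome_some, if_true, Option.getD_some,
    decodeQ_ratCode, Nat.unpair_pair]
  push_cast
  constructor <;> linarith

-- The argument is by Lebesgue measure. All stages of one program give the same interval or the
-- empty one, so the union has measure at most the sum of the lengths 2^-(e+2), which is 1/2, and
-- cannot contain [0,1].
open MeasureTheory in
theorem piClass_cover_nonempty : (piClass cover).Nonempty := by
  -- `J e` merges the intervals of all stages of program `e`; it is empty if the program diverges at
  -- `e + 4`.
  let J : ℕ → Set ℝ := fun e => {x | ∃ y ∈ (Denumerable.ofNat Code e).eval (e + 4),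
    |x - decodeQ y| < (1 / 2) ^ (e + 3)}
  have hJ : ∀ e, volume (J e) ≤ ENNReal.ofReal ((1 / 2) ^ (e + 2)) := by
    intro e
    by_cases h : ((Denumerable.ofNat Code e).eval (e + 4)).Dom
    · refine (measure_mono (t := Metric.ball
        ((decodeQ (((Denumerable.ofNat Code e).eval (e + 4)).get h) : ℚ) : ℝ)
        ((1 / 2) ^ (e + 3))) ?_).trans_eq ?_
      · rintro x ⟨y, hy, hxy⟩
        rw [Part.get_eq_of_mem hy]
        exact hxy
      · rw [Real.volume_ball]
        congr 1
        ring
    · refine le_of_eq_of_le (measure_mono_null ?_ measure_empty) zero_le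
      rintro x ⟨y, hy, -⟩
      exact h (Part.dom_iff_mem.2 ⟨y, hy⟩)
  have hsub : (⋃ n, Set.Ioo ((cover n).1 : ℝ) (cover n).2) ⊆ ⋃ e, J e := by
    refine Set.iUnion_subset fun n x hx => Set.mem_iUnion.2 ⟨n.unpair.1, ?_⟩
    simp only [cover, coverCenter, coverRadius] at hx
    rcases ho : coverOutput n with - | y
    · simp [ho] at hx
    · refine ⟨y, Code.evaln_sound (Option.mem_def.2 ho), ?_⟩
      simp [ho] at hx
      rw [abs_lt, one_div, inv_pow]
      constructor <;> linarith
  by_contra hne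
  have hcov : Set.Icc (0 : ℝ) 1 ⊆ ⋃ e, J e :=
    (Set.sdiff_eq_empty.1 (Set.not_nonempty_iff_eq_empty.1 hne)).trans hsub
  have hsum : HasSum (fun e : ℕ => (1 / 2 : ℝ) ^ (e + 2)) (1 / 2) := by
    have := hasSum_geometric_two.mul_left ((1 / 2 : ℝ) ^ 2)
    convert! this using 1
    · funext e; ring
    · norm_num
  have := calc
    ENNReal.ofReal 1 = volume (Set.Icc (0 : ℝ) 1) := by rw [Real.volume_Icc, sub_zero]
    _ ≤ ∑' e, volume (J e) := (measure_mono hcov).trans (measure_iUnion_le _)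
    _ ≤ ∑' e : ℕ, ENNReal.ofReal ((1 / 2) ^ (e + 2)) := ENNReal.tsum_le_tsum hJ
    _ = ENNReal.ofReal (1 / 2) := by
      rw [← ENNReal.ofReal_tsum_of_nonneg (fun _ => by positivity) hsum.summable, hsum.tsum_eq]
  rw [ENNReal.ofReal_le_ofReal_iff (by norm_num)] at this
  norm_num at this

theorem not_isComputableReal_of_mem_piClass_cover {x : ℝ} (hx : x ∈ piClass cover) :
    ¬ IsComputableReal x := fun h => hx.2 (Set.mem_iUnion.2 (exists_mem_cover h))

theorem spikeSum_cover_pos {x : ℝ} (hx : x ∈ Set.Icc (0 : ℝ) 1) (h : IsComputableReal x) :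
    0 < spikeSum cover x :=
  (spikeSum_pos_iff cover hx).2 fun hK => not_isComputableReal_of_mem_piClass_cover hK h

theorem not_hasComputableFinePartition_spikeSum_cover :
    ¬ HasComputableFinePartition (spikeSum cover) := by
  rintro ⟨ℓ, x, t, h0, h1, -, ht, hxt, hf⟩
  refine not_hasFinePartition cover piClass_cover_nonempty h0 h1 hxt (fun j hj => ?_) hf
  have hlo : ∀ j ≤ ℓ, 0 ≤ x j := fun j hj => by
    induction j with
    | zero => exact h0.ge
    | succ j ih => linarith [ih (by omega), hxt j (by omega)]
  -- The upper bound is obtained by descending from `x ℓ = 1`.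
  have hhi : ∀ j ≤ ℓ, x (ℓ - j) ≤ 1 := fun j hj => by
    induction j with
    | zero => exact h1.le
    | succ j ih =>
      have := hxt (ℓ - (j + 1)) (by omega)
      rw [show ℓ - (j + 1) + 1 = ℓ - j by omega] at this
      linarith [ih (by omega)]
  have h2 := hhi (ℓ - (j + 1)) (by omega)
  rw [show ℓ - (ℓ - (j + 1)) = j + 1 by omega] at h2
  exact spikeSum_cover_pos ⟨by linarith [hlo j hj.le, hxt j hj], by linarith [hxt j hj]⟩ (ht j hj)

end SOA

namespace SOA

/-! ### A computable code of the sum of spikes -/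

/-- The code of the pair of the intervals `(p, q)` and `(r, s)`. -/
def boxNat (p q r s : ℚ) : ℕ :=
  natPair (natPair (ratCode p) (ratCode q)) (natPair (ratCode r) (ratCode s))

@[simp] theorem boxNat_inj {p q r s p' q' r' s' : ℚ} :
    boxNat p q r s = boxNat p' q' r' s' ↔ p = p' ∧ q = q' ∧ r = r' ∧ s = s' := by
  simp [boxNat, ratCode_injective.eq_iff, and_assoc]

/-- The midpoint of `(p, q) ∩ [0, 1]`. -/
def unitMid (p q : ℚ) : ℚ := (max p 0 + min q 1) * (1 / 2)

/-- Half of the length of `(p, q) ∩ [0, 1]`. -/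
def unitRadius (p q : ℚ) : ℚ := (min q 1 - max p 0) * (1 / 2)

/-- The number of spikes that are taken into account on `(p, q) ∩ [0, 1]`. -/
def unitStage (p q : ℚ) : ℕ := ⌊(unitRadius p q)⁻¹⌋₊

/-- The bounds which the partial sum at the midpoint gives for `spikeSum ψ` on `(p, q) ∩ [0, 1]`
place its values in `(r, s)`. -/
def InCode (ψ : ℕ → ℚ × ℚ) (p q r s : ℚ) : Prop :=
  p < q ∧ p < 1 ∧ 0 < q ∧
    r < spikePartialSum ψ (unitStage p q) (unitMid p q) - unitRadius p q ∧
    spikePartialSum ψ (unitStage p q) (unitMid p q) + (1 / 2) ^ (unitStage p q + 2) +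
      unitRadius p q < s

def codeSet (ψ : ℕ → ℚ × ℚ) : Set ℕ := {z | ∃ p q r s, z = boxNat p q r s ∧ InCode ψ p q r s}

variable {ψ : ℕ → ℚ × ℚ} {p q r s p' q' r' s' : ℚ}

@[simp] theorem boxNat_mem_codeSet : boxNat p q r s ∈ codeSet ψ ↔ InCode ψ p q r s := by
  constructor
  · rintro ⟨p', q', r', s', h, h'⟩
    obtain ⟨rfl, rfl, rfl, rfl⟩ := boxNat_inj.1 h
    exact h'
  · exact fun h => ⟨p, q, r, s, rfl, h⟩

theorem codeSet_mem_REC (h₁ : QComputable fun k => (ψ k).1) (h₂ : QComputable fun k => (ψ k).2) :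
    codeSet ψ ∈ REC := by
  have hf := computable_natFst
  have hs := computable_natSnd
  have hp : QComputable fun z => decodeQ (natFst (natFst z)) :=
    qcomputable_decodeQ.comp (hf.comp hf)
  have hq : QComputable fun z => decodeQ (natSnd (natFst z)) :=
    qcomputable_decodeQ.comp (hs.comp hf)
  have hr : QComputable fun z => decodeQ (natFst (natSnd z)) :=
    qcomputable_decodeQ.comp (hf.comp hs)
  have hs : QComputable fun z => decodeQ (natSnd (natSnd z)) :=
    qcomputable_decodeQ.comp (hs.comp hs)
  have hl := hp.max (.const 0)
  have hu := hq.min (.const 1)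
  have hrad := (hu.sub hl).mul (.const (1 / 2))
  have hst := hrad.floor_inv
  have hsum := qcomputable_spikePartialSum h₁ h₂ hst ((hl.add hu).mul (.const (1 / 2)))
  -- Decoding is total on numbers, so comparing `z` with the code of its decoded parts singles out
  -- the genuine codes of boxes.
  refine ((ComputablePred.eq .id ((hp.ratCode.natPair hq.ratCode).natPair
    (hr.ratCode.natPair hs.ratCode))).and ((hp.lt hq).and ((hp.lt (.const 1)).and
    (((QComputable.const 0).lt hq).and ((hr.lt (hsum.sub hrad)).and
    (((hsum.add (.half_pow (hst.nat_add (.const 2)))).add hrad).lt hs)))))).of_eq fun z => ?_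
  constructor
  · exact fun h => ⟨_, _, _, _, h⟩
  · rintro ⟨p, q, r, s, rfl, h⟩
    simp only [boxNat, natFst_natPair, natSnd_natPair, decodeQ_ratCode]
    exact ⟨rfl, h⟩

theorem unitRadius_pos (h₁ : p < q) (h₂ : p < 1) (h₃ : 0 < q) : 0 < unitRadius p q := by
  have : max p 0 < min q 1 := by simp [*]
  unfold unitRadius
  linarith

theorem abs_sub_unitMid_le {x : ℝ} (hx : x ∈ Set.Icc (0 : ℝ) 1) (h₁ : (p : ℝ) < x) (h₂ : x < q) :
    |x - unitMid p q| ≤ unitRadius p q := by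
  have h1 : max (p : ℝ) 0 ≤ x := max_le h₁.le hx.1
  have h2 : x ≤ min (q : ℝ) 1 := le_min h₂.le hx.2
  rw [abs_le, unitMid, unitRadius]
  push_cast
  constructor <;> linarith

theorem InCode.spikeSum_mem (h : InCode ψ p q r s) {x : ℝ} (hx : x ∈ Set.Icc (0 : ℝ) 1)
    (h₁ : (p : ℝ) < x) (h₂ : x < q) : (r : ℝ) < spikeSum ψ x ∧ spikeSum ψ x < s := by
  obtain ⟨-, -, -, h3, h4⟩ := h
  have h3 := (Rat.cast_lt (K := ℝ)).2 h3
  have h4 := (Rat.cast_lt (K := ℝ)).2 h4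
  push_cast at h3 h4
  have h5 := abs_le.1 ((abs_spikeSum_sub_le ψ x (unitMid p q)).trans
    (abs_sub_unitMid_le hx h₁ h₂))
  have h6 := spikePartialSum_le ψ (unitStage p q) (unitMid p q)
  have h7 := spikeSum_le ψ (unitStage p q) (unitMid p q)
  constructor <;> linarith

/-- Both value intervals contain the same nonempty enclosure, which depends on `p` and `q` alone. -/
theorem InCode.lt (h : InCode ψ p q r s) (h' : InCode ψ p q r' s') : r < s' := by
  have h1 := unitRadius_pos h.1 h.2.1 h.2.2.1
  have h2 : (0 : ℚ) < (1 / 2) ^ (unitStage p q + 2) := by positivity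
  linarith [h.2.2.2.1, h'.2.2.2.2]

theorem InCode.mono_right (h : InCode ψ p q r s) (hr : r' ≤ r) (hs : s ≤ s') :
    InCode ψ p q r' s' :=
  ⟨h.1, h.2.1, h.2.2.1, hr.trans_lt h.2.2.2.1, h.2.2.2.2.trans_le hs⟩

/-- The enclosures are nested. Shrinking the interval moves its midpoint by at most the loss in
radius, which absorbs the change of the 1-Lipschitz partial sum; and `unitStage`, the floor of the
inverse radius, can only grow, which tightens both bounds at a fixed point. -/
theorem InCode.mono_left (h : InCode ψ p q r s) (h₁ : p' < q') (h₂ : p' < 1) (h₃ : 0 < q')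
    (hp : p < 0 ∨ p ≤ p') (hq : 1 < q ∨ q' ≤ q) : InCode ψ p' q' r s := by
  have hl : max p 0 ≤ max p' 0 := by
    rcases hp with hp | hp
    · exact (max_eq_right hp.le).trans_le (le_max_right _ _)
    · exact max_le_max_right _ hp
  have hu : min q' 1 ≤ min q 1 := by
    rcases hq with hq | hq
    · exact (min_le_right _ _).trans_eq (min_eq_right hq.le).symm
    · exact min_le_min_right _ hq
  have hpos := unitRadius_pos h₁ h₂ h₃
  have hrad : unitRadius p' q' ≤ unitRadius p q := by unfold unitRadius; linarith
  have hmid : |unitMid p' q' - unitMid p q| ≤ unitRadius p q - unitRadius p' q' := by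
    unfold unitRadius unitMid
    rw [abs_le]
    constructor <;> linarith
  have hst : unitStage p q ≤ unitStage p' q' := Nat.floor_le_floor (inv_anti₀ hpos hrad)
  have h5 := abs_le.1 ((abs_spikePartialSum_sub_le ψ (unitStage p q) _ _).trans hmid)
  have h6 := spikePartialSum_mono ψ hst (unitMid p' q')
  have h7 := spikePartialSum_add_antitone ψ hst (unitMid p' q')
  obtain ⟨-, -, -, h8, h9⟩ := h
  exact ⟨h₁, h₂, h₃, by linarith, by linarith⟩

/-- Radius and truncation error are both at most η/8. With a margin of η/8 at each end for the
strict inequalities, the value interval has length at most 5η/8. -/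
theorem exists_inCode (ψ : ℕ → ℚ × ℚ) {x : ℝ} (hx : x ∈ Set.Icc (0 : ℝ) 1) {η : ℚ} (hη : 0 < η) :
    ∃ p q r s, InCode ψ p q r s ∧ (p : ℝ) < x ∧ x < q ∧ s - r ≤ η := by
  have hη' : (0 : ℝ) < η := mod_cast hη
  obtain ⟨p, hp, hpx⟩ := exists_rat_btwn (show x - η / 8 < x by linarith)
  obtain ⟨q, hxq, hq⟩ := exists_rat_btwn (show x < x + η / 8 by linarith)
  have h₁ : p < q := by exact_mod_cast hpx.trans hxq
  have h₂ : p < 1 := by exact_mod_cast hpx.trans_le hx.2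
  have h₃ : 0 < q := by exact_mod_cast hx.1.trans_lt hxq
  have hpos := unitRadius_pos h₁ h₂ h₃
  have hlen : q - p < η / 4 := by
    have : ((q - p : ℚ) : ℝ) < ((η / 4 : ℚ) : ℝ) := by push_cast; linarith
    exact_mod_cast this
  have hrad : unitRadius p q ≤ η / 8 := by
    have := le_max_left p 0
    have := min_le_left q 1
    unfold unitRadius
    linarith
  -- The stage exceeds the inverse radius minus 1, and `n < 2 ^ n`.
  have herr : (1 / 2 : ℚ) ^ (unitStage p q + 2) ≤ unitRadius p q := by
    have h1 : (unitRadius p q)⁻¹ < (unitStage p q + 2 : ℕ) :=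
      (Nat.lt_floor_add_one _).trans (by push_cast [unitStage]; linarith)
    have h2 : ((unitStage p q + 2 : ℕ) : ℚ) < 2 ^ (unitStage p q + 2) :=
      mod_cast Nat.lt_two_pow_self
    rw [one_div, inv_pow]
    exact inv_le_of_inv_le₀ hpos (h1.trans h2).le
  exact ⟨p, q, spikePartialSum ψ (unitStage p q) (unitMid p q) - unitRadius p q - η / 8,
    spikePartialSum ψ (unitStage p q) (unitMid p q) + (1 / 2) ^ (unitStage p q + 2) +
      unitRadius p q + η / 8, ⟨h₁, h₂, h₃, by linarith, by linarith⟩, hpx, hxq, by linarith⟩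

theorem codesFunction_codeSet (ψ : ℕ → ℚ × ℚ) : CodesFunction (codeSet ψ) (spikeSum ψ) := by
  refine ⟨fun p q r s h x hx h₁ h₂ => InCode.spikeSum_mem (boxNat_mem_codeSet.1 h) hx h₁ h₂,
    fun x hx η hη => ?_⟩
  obtain ⟨p, q, r, s, h, h'⟩ := exists_inCode ψ hx hη
  exact ⟨p, q, r, s, boxNat_mem_codeSet.2 h, h'⟩

/-! ### Sets coding real numbers -/

/-- The sequence of rational numbers `x`, as a set of pairs. -/
def seqSet (x : ℕ → ℚ) : Set ℕ := {z | ∃ k, z = natPair k (ratCode (x k))}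

@[simp] theorem natPair_mem_seqSet {x : ℕ → ℚ} {k c : ℕ} :
    natPair k c ∈ seqSet x ↔ c = ratCode (x k) := by
  simp [seqSet]

/-- A function with a decidable graph is computed by searching for the value; conversely, the graph
is decided by computing the value. -/
theorem seqSet_mem_REC {x : ℕ → ℚ} : seqSet x ∈ REC ↔ QComputable x := by
  classical
  constructor
  · intro h
    have hex : ∀ k, ∃ c, natPair k c ∈ seqSet x := fun k => ⟨_, natPair_mem_seqSet.2 rfl⟩
    refine qcomputable_iff.2 ((Computable.find (P := fun k c => natPair k c ∈ seqSet x)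
      (ComputablePred.comp h (Computable.fst.natPair .snd)) hex).of_eq fun k => ?_)
    exact natPair_mem_seqSet.1 (Nat.find_spec (hex k))
  · intro h
    refine (ComputablePred.eq .id (computable_natFst.natPair
      (h.comp computable_natFst).ratCode)).of_eq fun z => ?_
    exact ⟨fun hz => ⟨_, hz⟩, by rintro ⟨k, rfl⟩; simp⟩

/-- The set `A` codes the real number `X`. -/
def IsRealCode (A : Set ℕ) (X : ℝ) : Prop :=
  ∃ x : ℕ → ℚ, A = seqSet x ∧ (∀ i j, i ≤ j → |x i - x j| ≤ (1 / 2) ^ i) ∧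
    Filter.Tendsto (fun k => (x k : ℝ)) Filter.atTop (nhds X)

theorem IsRealCode.isComputableReal {A : Set ℕ} {X : ℝ} (h : IsRealCode A X) (hA : A ∈ REC) :
    IsComputableReal X := by
  obtain ⟨x, rfl, h⟩ := h
  exact ⟨x, (seqSet_mem_REC.1 hA).ratCode, h⟩

theorem abs_sub_le_of_tendsto {x : ℕ → ℚ} {X : ℝ}
    (hc : ∀ i j, i ≤ j → |x i - x j| ≤ (1 / 2) ^ i)
    (hX : Filter.Tendsto (fun k => (x k : ℝ)) Filter.atTop (nhds X)) (k : ℕ) :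
    |(x k : ℝ) - X| ≤ (1 / 2) ^ k := by
  refine le_of_tendsto ((tendsto_const_nhds.sub hX).abs)
    (Filter.eventually_atTop.2 ⟨k, fun j hj => ?_⟩)
  have := (Rat.cast_le (K := ℝ)).2 (hc k j hj)
  push_cast at this
  exact this

theorem IsRealCode.unique {A : Set ℕ} {X Y : ℝ} (hX : IsRealCode A X) (hY : IsRealCode A Y) :
    X = Y := by
  obtain ⟨x, rfl, -, hX⟩ := hX
  obtain ⟨y, h, -, hY⟩ := hY
  have : x = y := funext fun k => by
    have hk : natPair k (ratCode (x k)) ∈ seqSet y := h ▸ natPair_mem_seqSet.2 rfl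
    exact ratCode_injective (natPair_mem_seqSet.1 hk)
  exact tendsto_nhds_unique hX (this ▸ hY)

theorem exists_isRealCode_spikeSum (h₁ : QComputable fun k => (ψ k).1)
    (h₂ : QComputable fun k => (ψ k).2) {A : Set ℕ} (hA : A ∈ REC) {X : ℝ} (h : IsRealCode A X) :
    ∃ B ∈ REC, IsRealCode B (spikeSum ψ X) := by
  obtain ⟨x, rfl, hc, hX⟩ := h
  have hx := seqSet_mem_REC.1 hA
  -- The shift by 2 keeps the error within 2^-(k+1): at most 2^-(k+3) comes from the argument and
  -- 2^-(k+4) from truncation. Two such errors fit into the modulus 2^-k required of a real.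
  let y : ℕ → ℚ := fun k => spikePartialSum ψ (k + 2) (x (k + 2))
  have hy : QComputable y := qcomputable_spikePartialSum h₁ h₂
    (Computable.id.nat_add (.const 2)) (hx.comp (Computable.id.nat_add (.const 2)))
  have hd : ∀ k, |(y k : ℝ) - spikeSum ψ X| ≤ (1 / 2) ^ (k + 1) := fun k => by
    have h3 := abs_le.1 ((abs_spikeSum_sub_le_half ψ (x (k + 2)) X).trans
      (mul_le_mul_of_nonneg_left (abs_sub_le_of_tendsto hc hX (k + 2)) (by norm_num)))
    have h4 := spikePartialSum_le ψ (k + 2) (x (k + 2))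
    have h5 := spikeSum_le ψ (k + 2) (x (k + 2))
    have h6 : (0 : ℝ) < (1 / 2) ^ k := by positivity
    simp only [pow_add] at h3 h5 ⊢
    rw [abs_le]
    constructor <;> simp only [y] <;> linarith
  refine ⟨seqSet y, seqSet_mem_REC.2 hy, y, rfl, fun i j hij => ?_, ?_⟩
  · have h3 := abs_le.1 (hd i)
    have h4 := abs_le.1 (hd j)
    have h5 : (1 / 2 : ℝ) ^ (j + 1) ≤ (1 / 2) ^ (i + 1) :=
      pow_le_pow_of_le_one (by norm_num) (by norm_num) (by omega)
    have h6 : |(y i : ℝ) - y j| ≤ (1 / 2) ^ i := by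
      rw [pow_succ _ i] at h3 h5
      rw [abs_le]
      constructor <;> linarith
    exact_mod_cast (show ((|y i - y j| : ℚ) : ℝ) ≤ ((1 / 2 : ℚ) ^ i : ℚ) by push_cast; exact h6)
  · rw [tendsto_iff_norm_sub_tendsto_zero]
    exact squeeze_zero (fun _ => norm_nonneg _) hd ((tendsto_pow_atTop_nhds_zero_of_lt_one
      (by norm_num) (by norm_num)).comp (Filter.tendsto_add_atTop_nat 1))

end SOA

namespace SOA

/-! ### The meaning of the formulae of the number systems in `ω`-models -/

section Numbers

variable {n m : ℕ} {M : Set (Set ℕ)} {v : Fin n → ℕ} {w : Fin m → Set ℕ}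

@[simp] theorem Formula.holds_allN {F : Term (n + 1) → Formula (n + 1) m} :
    (allN F).Holds M v w ↔ ∀ a : ℕ, (F (.var 0)).Holds M (Fin.cons a v) w := Iff.rfl

@[simp] theorem Formula.holds_exN {F : Term (n + 1) → Formula (n + 1) m} :
    (exN F).Holds M v w ↔ ∃ a : ℕ, (F (.var 0)).Holds M (Fin.cons a v) w := Iff.rfl

@[simp] theorem Formula.holds_allS {F : SetVar (m + 1) → Formula n (m + 1)} :
    (allS F).Holds M v w ↔ ∀ A ∈ M, (F ⟨0⟩).Holds M v (Fin.cons A w) := Iff.rfl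

@[simp] theorem Formula.holds_exS {F : SetVar (m + 1) → Formula n (m + 1)} :
    (exS F).Holds M v w ↔ ∃ A ∈ M, (F ⟨0⟩).Holds M v (Fin.cons A w) := Iff.rfl

@[simp] theorem Term.eval_var_zero (a : ℕ) :
    (Term.var 0 : Term (n + 1)).eval (Fin.cons a v : Fin (n + 1) → ℕ) = a := rfl

@[simp] theorem SetVar.cons_lift (X : SetVar m) (A : Set ℕ) :
    (Fin.cons A w : Fin (m + 1) → Set ℕ) X.lift.idx = w X.idx := rfl

@[simp] theorem SetVar.cons_zero (A : Set ℕ) :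
    (Fin.cons A w : Fin (m + 1) → Set ℕ) (SetVar.mk 0).idx = A := rfl

@[simp] theorem holds_le {s t : Term n} :
    (le s t : Formula n m).Holds M v w ↔ s.eval v ≤ t.eval v :=
  Nat.le_iff_lt_or_eq.symm

@[simp] theorem eval_pair {s t : Term n} : (pair s t).eval v = natPair (s.eval v) (t.eval v) := rfl

theorem natPair_le_natPair {a b c d : ℕ} (h₁ : a ≤ c) (h₂ : b ≤ d) : natPair a b ≤ natPair c d :=
  Nat.add_le_add (Nat.mul_le_mul (by omega) (by omega)) h₁

-- If both components are positive, subtracting 1 from each gives an equivalent pair with a smaller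
-- code; if one is 0, the pair is componentwise least in its class.
@[simp] theorem holds_isInt {a b : Term n} :
    (isInt a b : Formula n m).Holds M v w ↔ a.eval v = 0 ∨ b.eval v = 0 := by
  simp only [isInt, Formula.holds_allN, Formula.Holds, Term.eval, Term.eval_lift,
    Fin.cons_zero, holds_le, eval_pair]
  constructor
  · intro h
    by_contra! hc
    have h1 := h (a.eval v - 1) (b.eval v - 1) (by omega)
    rw [← not_lt] at h1
    exact h1 (Nat.add_lt_add_of_le_of_lt (Nat.mul_le_mul (by omega) (by omega)) (by omega))
  · intro h p q e
    exact natPair_le_natPair (by omega) (by omega)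

/-- The rational number represented by the term `ρ`. -/
def RatTerm.eval (ρ : RatTerm n) (v : Fin n → ℕ) : ℚ :=
  ((ρ.pos.eval v : ℚ) - ρ.neg.eval v) / ρ.den.eval v

/-- The denominator of `ρ` is positive. -/
def RatTerm.DenPos (ρ : RatTerm n) (v : Fin n → ℕ) : Prop := 0 < ρ.den.eval v

namespace RatTerm

@[simp] theorem eval_lift (ρ : RatTerm n) (a : ℕ) :
    ρ.lift.eval (Fin.cons a v : Fin (n + 1) → ℕ) = ρ.eval v := by
  simp [eval, lift]

@[simp] theorem code_lift_eval (ρ : RatTerm n) (a : ℕ) :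
    ρ.lift.code.eval (Fin.cons a v : Fin (n + 1) → ℕ) = ρ.code.eval v := by
  simp [code, lift, Term.eval]

theorem eval_mk (a b d : Term n) :
    (⟨a, b, d⟩ : RatTerm n).eval v = ((a.eval v : ℚ) - b.eval v) / d.eval v := rfl

theorem code_eval (ρ : RatTerm n) : ρ.code.eval v =
    natPair (natPair (ρ.pos.eval v) (ρ.neg.eval v)) (natPair (ρ.den.eval v) 0) := rfl

@[simp] theorem eval_zero : (zero : RatTerm n).eval v = 0 := by simp [eval, zero, Term.eval]

@[simp] theorem eval_one : (one : RatTerm n).eval v = 1 := by simp [eval, one, Term.eval]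

@[simp] theorem eval_inv (d : Term n) : (inv d).eval v = 1 / (d.eval v : ℚ) := by
  simp [eval, inv, Term.eval]

@[simp] theorem denPos_lift {ρ : RatTerm n} {a : ℕ} :
    ρ.lift.DenPos (Fin.cons a v : Fin (n + 1) → ℕ) ↔ ρ.DenPos v := by
  simp [DenPos, lift]

@[simp] theorem denPos_zero : (zero : RatTerm n).DenPos v := one_pos

@[simp] theorem denPos_one : (one : RatTerm n).DenPos v := one_pos

@[simp] theorem denPos_inv {d : Term n} : (inv d).DenPos v ↔ 0 < d.eval v := Iff.rfl

variable {ρ σ : RatTerm n}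

@[simp] theorem DenPos.add (h₁ : ρ.DenPos v) (h₂ : σ.DenPos v) : (ρ.add σ).DenPos v :=
  Nat.mul_pos h₁ h₂

@[simp] theorem DenPos.sub (h₁ : ρ.DenPos v) (h₂ : σ.DenPos v) : (ρ.sub σ).DenPos v :=
  Nat.mul_pos h₁ h₂

theorem eval_add (h₁ : ρ.DenPos v) (h₂ : σ.DenPos v) :
    (ρ.add σ).eval v = ρ.eval v + σ.eval v := by
  have h₁' : (ρ.den.eval v : ℚ) ≠ 0 := mod_cast h₁.ne'
  have h₂' : (σ.den.eval v : ℚ) ≠ 0 := mod_cast h₂.ne'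
  simp only [eval, add, Term.eval]
  push_cast
  field_simp
  ring

theorem eval_sub (h₁ : ρ.DenPos v) (h₂ : σ.DenPos v) :
    (ρ.sub σ).eval v = ρ.eval v - σ.eval v := by
  rw [sub, eval_add h₁ (by exact h₂)]
  simp only [eval]
  ring

theorem holds_eq (h₁ : ρ.DenPos v) (h₂ : σ.DenPos v) :
    (ρ.eq σ : Formula n m).Holds M v w ↔ ρ.eval v = σ.eval v := by
  have h₁' : (ρ.den.eval v : ℚ) ≠ 0 := mod_cast h₁.ne'
  have h₂' : (σ.den.eval v : ℚ) ≠ 0 := mod_cast h₂.ne'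
  simp only [eq, eval, Term.eval, Formula.Holds]
  rw [div_eq_div_iff h₁' h₂', ← Nat.cast_inj (R := ℚ)]
  push_cast
  constructor <;> intro <;> linarith

theorem holds_lt (h₁ : ρ.DenPos v) (h₂ : σ.DenPos v) :
    (ρ.lt σ : Formula n m).Holds M v w ↔ ρ.eval v < σ.eval v := by
  have h₁' : (0 : ℚ) < ρ.den.eval v := mod_cast h₁
  have h₂' : (0 : ℚ) < σ.den.eval v := mod_cast h₂
  simp only [lt, eval, Term.eval, Formula.Holds]
  rw [div_lt_div_iff₀ h₁' h₂', ← Nat.cast_lt (α := ℚ)]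
  push_cast
  constructor <;> intro <;> linarith

theorem holds_le (h₁ : ρ.DenPos v) (h₂ : σ.DenPos v) :
    (ρ.le σ : Formula n m).Holds M v w ↔ ρ.eval v ≤ σ.eval v := by
  have h₁' : (0 : ℚ) < ρ.den.eval v := mod_cast h₁
  have h₂' : (0 : ℚ) < σ.den.eval v := mod_cast h₂
  simp only [le, eval, Term.eval, SOA.holds_le]
  rw [div_le_div_iff₀ h₁' h₂', ← Nat.cast_le (α := ℚ)]
  push_cast
  constructor <;> intro <;> linarith

end RatTerm

/-- The hypothesis `hab` makes `a` and `b` the positive and negative parts of the numerator, so all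
three numbers arise from the lowest terms by one common factor. -/
theorem exists_eq_mul_of_fraction {a b d : ℕ} (hd : 0 < d) (hab : a = 0 ∨ b = 0) {q : ℚ}
    (hq : q = ((a : ℚ) - b) / d) :
    ∃ g, 0 < g ∧ a = q.num.toNat * g ∧ b = (-q.num).toNat * g ∧ d = q.den * g := by
  have hdvd := Rat.den_dvd (a - b : ℤ) d
  rw [Rat.divInt_eq_div, show (((a - b : ℤ) : ℚ) / ((d : ℤ) : ℚ)) = q by rw [hq]; push_cast; rfl]
    at hdvd
  obtain ⟨g, rfl⟩ := Int.natCast_dvd_natCast.1 hdvd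
  have hg : 0 < g := Nat.pos_of_mul_pos_left hd
  have e : q.num * (q.den * g : ℕ) = (a - b) * q.den := by
    have h : ((q.den * g : ℕ) : ℚ) ≠ 0 := mod_cast hd.ne'
    have h' : (q.den : ℚ) ≠ 0 := mod_cast q.den_ne_zero
    have e := (Rat.num_div_den q).trans hq
    rw [div_eq_div_iff h' h] at e
    exact_mod_cast e
  obtain ⟨h1, h2⟩ := toNat_mul_eq e
  refine ⟨g, hg, ?_, ?_, rfl⟩ <;> refine Nat.eq_of_mul_eq_mul_right q.pos ?_
  · rw [show a = a - b by omega, ← h1]; ring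
  · rw [show b = b - a by omega, ← h2]; ring

@[simp] theorem natPair_ratCode (q : ℚ) :
    natPair (natPair q.num.toNat (-q.num).toNat) (natPair q.den 0) = ratCode q := rfl

theorem RatTerm.holds_isRat {ρ : RatTerm n} : (ρ.isRat : Formula n m).Holds M v w ↔
    ∃ q : ℚ, ρ.pos.eval v = q.num.toNat ∧ ρ.neg.eval v = (-q.num).toNat ∧ ρ.den.eval v = q.den := by
  have key : (ρ.isRat : Formula n m).Holds M v w ↔
      (ρ.pos.eval v = 0 ∨ ρ.neg.eval v = 0) ∧ 0 < ρ.den.eval v ∧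
        ∀ a b d : ℕ, (a = 0 ∨ b = 0) ∧ 0 < d ∧ ρ.eval v = ((a : ℚ) - b) / d →
          ρ.code.eval v ≤ natPair (natPair a b) (natPair d 0) := by
    simp only [isRat, Formula.holds_allN, Formula.Holds, holds_isInt, Term.eval, SOA.holds_le,
      code_lift_eval]
    refine and_congr_right fun _ => and_congr_right fun hd => forall_congr' fun a =>
      forall_congr' fun b => forall_congr' fun d => imp_congr (and_congr_right fun _ =>
        and_congr_right fun hd' => ?_) Iff.rfl
    rw [holds_eq (denPos_lift.2 (denPos_lift.2 (denPos_lift.2 hd))) (by exact hd')]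
    simp [eval_mk]
  rw [key]
  constructor
  · rintro ⟨h1, h2, h3⟩
    obtain ⟨g, hg, ha, hb, hd⟩ := exists_eq_mul_of_fraction h2 h1 (q := ρ.eval v) rfl
    have hmin := h3 (ρ.eval v).num.toNat (-(ρ.eval v).num).toNat (ρ.eval v).den
      ⟨by omega, (ρ.eval v).pos, (toNat_sub_div_den _).symm⟩
    have hg1 : g = 1 := by
      by_contra hne
      have : (ρ.eval v).den < ρ.den.eval v := by
        rw [hd]
        exact lt_mul_of_one_lt_right (ρ.eval v).pos (by omega)
      rw [← not_lt] at hmin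
      -- A factor above 1 would make the reduced fraction have a smaller code. The strictness comes
      -- from the denominator, as the numerator may be 0.
      refine hmin (Nat.add_lt_add_of_lt_of_le ?_ (natPair_le_natPair ?_ ?_))
      · have hle : natPair (ρ.eval v).num.toNat (-(ρ.eval v).num).toNat ≤
            natPair (ρ.pos.eval v) (ρ.neg.eval v) := by
          rw [ha, hb]
          exact natPair_le_natPair (Nat.le_mul_of_pos_right _ hg) (Nat.le_mul_of_pos_right _ hg)
        have hlt : natPair (ρ.eval v).den 0 < natPair (ρ.den.eval v) 0 :=
          Nat.add_lt_add_of_le_of_lt (Nat.mul_le_mul (by omega) (by omega)) this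
        exact Nat.mul_self_lt_mul_self (Nat.add_lt_add_of_le_of_lt hle hlt)
      · rw [ha]; exact Nat.le_mul_of_pos_right _ hg
      · rw [hb]; exact Nat.le_mul_of_pos_right _ hg
    subst hg1
    exact ⟨ρ.eval v, by simpa using ha, by simpa using hb, by simpa using hd⟩
  · rintro ⟨q, ha, hb, hd⟩
    refine ⟨by omega, hd ▸ q.pos, fun a b d h => ?_⟩
    have hq : ρ.eval v = q := by rw [eval, ha, hb, hd, toNat_sub_div_den]
    obtain ⟨g, hg, h1, h2, h3⟩ := exists_eq_mul_of_fraction h.2.1 h.1 (hq ▸ h.2.2)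
    rw [code_eval, ha, hb, hd]
    refine natPair_le_natPair (natPair_le_natPair ?_ ?_) (natPair_le_natPair ?_ le_rfl) <;>
      simp only [*] <;> exact Nat.le_mul_of_pos_right _ hg

theorem holds_betaEq {c b i y : Term n} : (betaEq c b i y : Formula n m).Holds M v w ↔
    y.eval v = c.eval v % ((i.eval v + 1) * b.eval v + 1) := by
  simp only [betaEq, Formula.holds_exN, Formula.Holds, Term.eval, Term.eval_lift,
    Fin.cons_zero]
  constructor
  · rintro ⟨h, z, hz⟩
    rw [hz, Nat.mul_add_mod', Nat.mod_eq_of_lt h]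
  · intro h
    exact ⟨h ▸ Nat.mod_lt _ (Nat.succ_pos _), c.eval v / ((i.eval v + 1) * b.eval v + 1), by
      rw [h, Nat.div_add_mod']⟩

@[simp] theorem holds_isPow2 {k e : Term n} :
    (isPow2 k e : Formula n m).Holds M v w ↔ e.eval v = 2 ^ k.eval v := by
  simp only [isPow2, Formula.holds_exN, Formula.holds_allN, Formula.Holds, holds_betaEq,
    Term.eval, Term.eval_lift, Fin.cons_zero]
  constructor
  · rintro ⟨c, b, h0, hk, hs⟩
    have : ∀ i ≤ k.eval v, 2 ^ i = c % ((i + 1) * b + 1) := fun i hi => by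
      induction i with
      | zero => exact h0
      | succ i ih => rw [pow_succ, mul_two]; exact hs i _ ⟨by omega, ih (by omega)⟩
    rw [this _ le_rfl, hk]
  · intro he
    -- Gödel's β-function codes the list of powers up to exponent `k`; `betaEq` has the same form as
    -- `Nat.beta`.
    let l := (List.range (k.eval v + 1)).map (2 ^ ·)
    have h : ∀ i ≤ k.eval v, Nat.beta (Nat.unbeta l) i = 2 ^ i := fun i hi => by
      have hl : i < l.length := by simp [l]; omega
      have := Nat.beta_unbeta_coe l ⟨i, hl⟩
      simpa [l] using this
    simp only [Nat.beta] at h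
    refine ⟨_, _, (h 0 (Nat.zero_le _)).symm, he.trans (h _ le_rfl).symm, ?_⟩
    rintro i y ⟨hi, rfl⟩
    rw [h i hi.le, h (i + 1) hi, pow_succ, mul_two]

theorem holds_allQ {F : RatTerm (n + 3) → Formula (n + 3) m} : (allQ F).Holds M v w ↔
    ∀ q : ℚ, (F ⟨(Term.var 0).lift.lift, (Term.var 0).lift, .var 0⟩).Holds M
      (Fin.cons q.den (Fin.cons (-q.num).toNat (Fin.cons q.num.toNat v))) w := by
  simp only [allQ, Formula.holds_allN, Formula.Holds, RatTerm.holds_isRat, Term.eval_lift,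
    Term.eval_var_zero]
  constructor
  · intro h q
    exact h _ _ _ ⟨q, rfl, rfl, rfl⟩
  · rintro h a b d ⟨q, rfl, rfl, rfl⟩
    exact h q

theorem holds_exQ {F : RatTerm (n + 3) → Formula (n + 3) m} : (exQ F).Holds M v w ↔
    ∃ q : ℚ, (F ⟨(Term.var 0).lift.lift, (Term.var 0).lift, .var 0⟩).Holds M
      (Fin.cons q.den (Fin.cons (-q.num).toNat (Fin.cons q.num.toNat v))) w := by
  simp only [exQ, Formula.holds_exN, Formula.Holds, RatTerm.holds_isRat, Term.eval_lift,
    Term.eval_var_zero]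
  constructor
  · rintro ⟨a, b, d, ⟨q, rfl, rfl, rfl⟩, h⟩
    exact ⟨q, h⟩
  · rintro ⟨q, h⟩
    exact ⟨_, _, _, ⟨q, rfl, rfl, rfl⟩, h⟩

end Numbers

end SOA

namespace SOA

/-! ### The meaning of the formulae about reals and continuous functions -/

section Reals

variable {n m : ℕ} {M : Set (Set ℕ)} {v : Fin n → ℕ} {w : Fin m → Set ℕ}

@[simp] theorem RatTerm.eval_fraction (q : ℚ) :
    (⟨(Term.var 0).lift.lift, (Term.var 0).lift, .var 0⟩ : RatTerm (n + 3)).eval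
      (Fin.cons q.den (Fin.cons (-q.num).toNat (Fin.cons q.num.toNat v))) = q := by
  simp [RatTerm.eval_mk]

@[simp] theorem RatTerm.denPos_fraction (q : ℚ) :
    (⟨(Term.var 0).lift.lift, (Term.var 0).lift, .var 0⟩ : RatTerm (n + 3)).DenPos
      (Fin.cons q.den (Fin.cons (-q.num).toNat (Fin.cons q.num.toNat v))) := q.pos

@[simp] theorem RatTerm.code_fraction (q : ℚ) :
    (⟨(Term.var 0).lift.lift, (Term.var 0).lift, .var 0⟩ : RatTerm (n + 3)).code.eval
      (Fin.cons q.den (Fin.cons (-q.num).toNat (Fin.cons q.num.toNat v))) = ratCode q := by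
  simp [RatTerm.code_eval]

@[simp] theorem eval_boxCode {p q r s : RatTerm n} : (boxCode p q r s).eval v =
    natPair (natPair (p.code.eval v) (q.code.eval v)) (natPair (r.code.eval v) (s.code.eval v)) :=
  rfl

@[simp] theorem natPair_eq_boxNat (p q r s : ℚ) :
    natPair (natPair (ratCode p) (ratCode q)) (natPair (ratCode r) (ratCode s)) =
      boxNat p q r s := rfl

@[simp] theorem eval_twoInv {e : Term n} (he : 0 < e.eval v) :
    (twoInv e).eval v = 1 / (e.eval v : ℚ) + 1 / (e.eval v : ℚ) := by
  rw [twoInv, RatTerm.eval_add (by exact he) (by exact he), RatTerm.eval_inv]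

@[simp] theorem denPos_twoInv {e : Term n} (he : 0 < e.eval v) : (twoInv e).DenPos v :=
  Nat.mul_pos he he

/-- The universal quantifier over values collapses to the one value `x k`, because codes of
rationals are unique. -/
theorem holds_allVal {X : SetVar m} {x : ℕ → ℚ} (hx : w X.idx = seqSet x) {k : Term n}
    {F : RatTerm (n + 3) → Formula (n + 3) m} : (allVal X k F).Holds M v w ↔
      (F ⟨(Term.var 0).lift.lift, (Term.var 0).lift, .var 0⟩).Holds M
        (Fin.cons (x (k.eval v)).den (Fin.cons (-(x (k.eval v)).num).toNat
          (Fin.cons (x (k.eval v)).num.toNat v))) w := by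
  simp only [allVal, holds_allQ, Formula.Holds, eval_pair, Term.eval_lift,
    RatTerm.code_fraction, hx, natPair_mem_seqSet, ratCode_injective.eq_iff, forall_eq]

theorem holds_isSeqRat {X : SetVar m} : (isSeqRat X : Formula n m).Holds M v w ↔
    ∃ x : ℕ → ℚ, w X.idx = seqSet x := by
  simp only [isSeqRat, Formula.Holds, Formula.holds_allN, Formula.holds_exN, holds_exQ,
    eval_pair, Term.eval_lift, Term.eval_var_zero, RatTerm.code_fraction]
  constructor
  · rintro ⟨h1, h2⟩
    choose c hc hu using h2
    have h3 : ∀ k, ∃ q, c k = ratCode q := fun k => by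
      obtain ⟨k', q, hq⟩ := h1 _ (hc k)
      exact ⟨q, (natPair_inj.1 hq).2⟩
    choose x hx using h3
    refine ⟨x, Set.ext fun z => ⟨fun hz => ?_, ?_⟩⟩
    · obtain ⟨k, q, rfl⟩ := h1 z hz
      exact ⟨k, by rw [hu k _ hz, hx]⟩
    · rintro ⟨k, rfl⟩
      exact hx k ▸ hc k
  · rintro ⟨x, hx⟩
    rw [hx]
    exact ⟨fun z ⟨k, hk⟩ => ⟨k, x k, hk⟩, fun k => ⟨_, natPair_mem_seqSet.2 rfl,
      fun c hc => natPair_mem_seqSet.1 hc⟩⟩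

theorem exists_tendsto {x : ℕ → ℚ} (hc : ∀ i j, i ≤ j → |x i - x j| ≤ (1 / 2) ^ i) :
    ∃ X : ℝ, Filter.Tendsto (fun k => (x k : ℝ)) Filter.atTop (nhds X) := by
  refine cauchySeq_tendsto_of_complete (cauchySeq_of_le_tendsto_0 (fun i => 2 * (1 / 2 : ℝ) ^ i)
    (fun i j N hi hj => ?_) ?_)
  · have h : ∀ i, N ≤ i → |(x N : ℝ) - x i| ≤ (1 / 2) ^ N := fun i hi => by
      have := (Rat.cast_le (K := ℝ)).2 (hc N i hi)
      push_cast at this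
      exact this
    rw [Real.dist_eq]
    have h1 := abs_le.1 (h i hi)
    have h2 := abs_le.1 (h j hj)
    rw [abs_le]
    constructor <;> linarith
  · simpa using (tendsto_pow_atTop_nhds_zero_of_lt_one (by norm_num : (0 : ℝ) ≤ 1 / 2)
      (by norm_num)).const_mul 2

/-- The formula only asserts the modulus of convergence; the limit exists in ℝ by completeness, for
any `M`. -/
theorem holds_isReal {X : SetVar m} : (isReal X : Formula n m).Holds M v w ↔
    ∃ r, IsRealCode (w X.idx) r := by
  have key : ∀ x : ℕ → ℚ, w X.idx = seqSet x → ((isReal X : Formula n m).Holds M v w ↔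
      ∀ i j, i ≤ j → |x i - x j| ≤ (1 / 2) ^ i) := fun x hx => by
    have h : (isSeqRat X : Formula n m).Holds M v w := holds_isSeqRat.2 ⟨x, hx⟩
    simp only [isReal, Formula.Holds, h, true_and, Formula.holds_allN, holds_allVal hx, holds_le,
      holds_isPow2, Term.eval_lift, Term.eval_var_zero]
    refine forall_congr' fun i => forall_congr' fun j => ?_
    constructor
    · intro h hij
      have := h (2 ^ i) ⟨hij, rfl⟩
      simp [RatTerm.holds_le, RatTerm.eval_add, Nat.two_pow_pos] at this
      rw [abs_le, one_div, inv_pow]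
      constructor <;> linarith
    · rintro h e ⟨hij, rfl⟩
      have := h hij
      rw [abs_le, one_div, inv_pow] at this
      simp [RatTerm.holds_le, RatTerm.eval_add, Nat.two_pow_pos]
      constructor <;> linarith
  constructor
  · intro h
    obtain ⟨x, hx⟩ := holds_isSeqRat.1 h.1
    have hc := (key x hx).1 h
    obtain ⟨r, hr⟩ := exists_tendsto hc
    exact ⟨r, x, hx, hc, hr⟩
  · rintro ⟨r, x, hx, hc, -⟩
    exact (key x hx).2 hc

theorem forall_le_add_iff {u v : ℕ → ℚ} {U V : ℝ} (hu : ∀ k, |(u k : ℝ) - U| ≤ (1 / 2) ^ k)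
    (hv : ∀ k, |(v k : ℝ) - V| ≤ (1 / 2) ^ k) :
    (∀ k, u k ≤ v k + (1 / (2 ^ k : ℕ) + 1 / (2 ^ k : ℕ))) ↔ U ≤ V := by
  have hlim := tendsto_pow_atTop_nhds_zero_of_lt_one (by norm_num : (0 : ℝ) ≤ 1 / 2) (by norm_num)
  have hpow : ∀ k : ℕ, (1 / (2 ^ k : ℕ) : ℝ) = (1 / 2) ^ k := fun k => by simp
  have hcast : ∀ k, u k ≤ v k + (1 / (2 ^ k : ℕ) + 1 / (2 ^ k : ℕ)) ↔
      (u k : ℝ) ≤ v k + ((1 / 2) ^ k + (1 / 2) ^ k) := fun k => by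
    rw [← Rat.cast_le (K := ℝ), Rat.cast_add, Rat.cast_add, Rat.cast_div, Rat.cast_one,
      Rat.cast_natCast, hpow]
  simp only [hcast]
  constructor
  · intro h
    -- Two approximation errors of 2^-k add to the tolerance 2 · 2^-k.
    have h0 : ∀ k, U ≤ V + 4 * (1 / 2) ^ k := fun k => by
      linarith [h k, (abs_le.1 (hu k)).1, (abs_le.1 (hv k)).2]
    exact ge_of_tendsto' (by simpa using (hlim.const_mul 4).const_add V) h0
  · intro h k
    linarith [(abs_le.1 (hu k)).2, (abs_le.1 (hv k)).1]

variable {X Y T : SetVar m} {x y t : ℝ}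

theorem holds_realLe (hX : IsRealCode (w X.idx) x) (hY : IsRealCode (w Y.idx) y) :
    (realLe X Y : Formula n m).Holds M v w ↔ x ≤ y := by
  obtain ⟨a, ha, hac, hal⟩ := hX
  obtain ⟨b, hb, hbc, hbl⟩ := hY
  rw [← forall_le_add_iff (abs_sub_le_of_tendsto hac hal) (abs_sub_le_of_tendsto hbc hbl)]
  simp only [realLe, Formula.Holds, Formula.holds_allN, holds_allVal ha, holds_allVal hb,
    holds_isPow2, Term.eval_lift, Term.eval_var_zero, forall_eq]
  refine forall_congr' fun k => ?_
  rw [RatTerm.holds_le (by simp) (.add (by simp) (by simp)), RatTerm.eval_add (by simp) (by simp)]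
  simp

theorem holds_realLeRat (hX : IsRealCode (w X.idx) x) {ρ : RatTerm n} (hρ : ρ.DenPos v) :
    (realLeRat X ρ : Formula n m).Holds M v w ↔ x ≤ ρ.eval v := by
  obtain ⟨a, ha, hac, hal⟩ := hX
  rw [← forall_le_add_iff (abs_sub_le_of_tendsto hac hal) (v := fun _ => ρ.eval v)
    (fun k => by simp)]
  simp only [realLeRat, Formula.Holds, Formula.holds_allN, holds_allVal ha,
    holds_isPow2, Term.eval_lift, Term.eval_var_zero, forall_eq]
  refine forall_congr' fun k => ?_
  rw [RatTerm.holds_le (by simp) (.add (by simpa using hρ) (by simp)),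
    RatTerm.eval_add (by simpa using hρ) (by simp)]
  simp

theorem holds_ratLeReal (hX : IsRealCode (w X.idx) x) {ρ : RatTerm n} (hρ : ρ.DenPos v) :
    (ratLeReal ρ X : Formula n m).Holds M v w ↔ ρ.eval v ≤ x := by
  obtain ⟨a, ha, hac, hal⟩ := hX
  rw [← forall_le_add_iff (u := fun _ => ρ.eval v) (fun k => by simp)
    (abs_sub_le_of_tendsto hac hal)]
  simp only [ratLeReal, Formula.Holds, Formula.holds_allN, holds_allVal ha,
    holds_isPow2, Term.eval_lift, Term.eval_var_zero, forall_eq]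
  refine forall_congr' fun k => ?_
  rw [RatTerm.holds_le (by simpa using hρ) (.add (by simp) (by simp)), RatTerm.eval_add (by simp) (by simp)]
  simp

/-- The index shift halves each error, so that a sum of reals keeps the modulus 2^-k. -/
theorem abs_add_sub_add_le {a b : ℕ → ℚ} {U V : ℝ} (ha : ∀ k, |(a k : ℝ) - U| ≤ (1 / 2) ^ k)
    (hb : ∀ k, |(b k : ℝ) - V| ≤ (1 / 2) ^ k) (k : ℕ) :
    |((a (k + 1) + b (k + 1) : ℚ) : ℝ) - (U + V)| ≤ (1 / 2) ^ k := by
  have h1 := abs_le.1 (ha (k + 1))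
  have h2 := abs_le.1 (hb (k + 1))
  rw [pow_succ] at h1 h2
  push_cast
  rw [abs_le]
  constructor <;> linarith

theorem holds_subLe (hT : IsRealCode (w T.idx) t) (hY : IsRealCode (w Y.idx) y)
    (hX : IsRealCode (w X.idx) x) : (subLe T Y X : Formula n m).Holds M v w ↔ t - y ≤ x := by
  obtain ⟨a, ha, hac, hal⟩ := hX
  obtain ⟨b, hb, hbc, hbl⟩ := hY
  obtain ⟨c, hc, hcc, hcl⟩ := hT
  rw [sub_eq_add_neg, ← forall_le_add_iff (abs_add_sub_add_le (abs_sub_le_of_tendsto hcc hcl)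
    (b := fun k => - b k) (fun k => by
      rw [Rat.cast_neg, ← neg_add', abs_neg, ← sub_eq_add_neg]
      exact abs_sub_le_of_tendsto hbc hbl k)) (abs_sub_le_of_tendsto hac hal)]
  simp only [subLe, Formula.Holds, Formula.holds_allN, holds_allVal ha, holds_allVal hb,
    holds_allVal hc, holds_isPow2, Term.eval_lift, Term.eval, Fin.cons_zero,
    forall_eq]
  refine forall_congr' fun k => ?_
  rw [RatTerm.holds_le (by simp) (.add (by simp) (by simp)), RatTerm.eval_add (by simp) (by simp),
    RatTerm.eval_sub (by simp) (by simp)]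
  simp [sub_eq_add_neg]

theorem holds_leAdd (hX : IsRealCode (w X.idx) x) (hT : IsRealCode (w T.idx) t)
    (hY : IsRealCode (w Y.idx) y) : (leAdd X T Y : Formula n m).Holds M v w ↔ x ≤ t + y := by
  obtain ⟨a, ha, hac, hal⟩ := hX
  obtain ⟨b, hb, hbc, hbl⟩ := hY
  obtain ⟨c, hc, hcc, hcl⟩ := hT
  rw [← forall_le_add_iff (abs_sub_le_of_tendsto hac hal)
    (abs_add_sub_add_le (abs_sub_le_of_tendsto hcc hcl) (abs_sub_le_of_tendsto hbc hbl))]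
  simp only [leAdd, Formula.Holds, Formula.holds_allN, holds_allVal ha, holds_allVal hb,
    holds_allVal hc, holds_isPow2, Term.eval_lift, Term.eval, Fin.cons_zero,
    forall_eq]
  refine forall_congr' fun k => ?_
  rw [RatTerm.holds_le (by simp) (.add (.add (by simp) (by simp)) (by simp)), RatTerm.eval_add (by simp) (by simp),
    RatTerm.eval_add (by simp) (by simp)]
  simp

theorem holds_inUnit : (inUnit X : Formula n m).Holds M v w ↔
    ∃ x ∈ Set.Icc (0 : ℝ) 1, IsRealCode (w X.idx) x := by
  simp only [inUnit, Formula.Holds, holds_isReal]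
  constructor
  · rintro ⟨⟨x, hx⟩, h⟩
    rw [holds_ratLeReal hx (by simp), holds_realLeRat hx (by simp)] at h
    exact ⟨x, by simpa using h, hx⟩
  · rintro ⟨x, h, hx⟩
    rw [holds_ratLeReal hx (by simp), holds_realLeRat hx (by simp)]
    exact ⟨⟨x, hx⟩, by simpa using h⟩

theorem holds_inInterval (hX : IsRealCode (w X.idx) x) {p q : RatTerm n} (hp : p.DenPos v)
    (hq : q.DenPos v) : (inInterval X p q : Formula n m).Holds M v w ↔
      x ∈ Set.Icc (0 : ℝ) 1 ∧ p.eval v < x ∧ x < q.eval v := by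
  have h : (∃ y ∈ Set.Icc (0 : ℝ) 1, IsRealCode (w X.idx) y) ↔ x ∈ Set.Icc (0 : ℝ) 1 :=
    ⟨fun ⟨y, hy, h⟩ => hX.unique h ▸ hy, fun h => ⟨x, h, hX⟩⟩
  simp only [inInterval, Formula.Holds, holds_inUnit, h, ratLtReal, realLtRat,
    holds_realLeRat hX hp, holds_ratLeReal hX hq, not_le]

variable {f : SetVar m}

theorem holds_inDomain (hX : IsRealCode (w X.idx) x) : (inDomain f X : Formula n m).Holds M v w ↔
    ∀ η : ℚ, 0 < η → ∃ p q r s : ℚ, boxNat p q r s ∈ w f.idx ∧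
      (x ∈ Set.Icc (0 : ℝ) 1 ∧ p < x ∧ x < q) ∧ s - r ≤ η := by
  simp [inDomain, holds_allQ, exBox, holds_exQ, Formula.Holds, holds_inInterval hX,
    RatTerm.holds_lt, RatTerm.holds_le, RatTerm.eval_sub]

theorem holds_isValue (hX : IsRealCode (w X.idx) x) (hY : IsRealCode (w Y.idx) y) :
    (isValue f X Y : Formula n m).Holds M v w ↔ (inDomain f X : Formula n m).Holds M v w ∧
      ∀ p q r s : ℚ, boxNat p q r s ∈ w f.idx → (x ∈ Set.Icc (0 : ℝ) 1 ∧ p < x ∧ x < q) →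
        r ≤ y ∧ y ≤ s := by
  have h : ∃ y, IsRealCode (w Y.idx) y := ⟨y, hY⟩
  simp [isValue, allBox, holds_allQ, Formula.Holds, holds_inInterval hX, holds_isReal, h,
    holds_ratLeReal hY, holds_realLeRat hY]

theorem holds_isContFun : (isContFun f : Formula n m).Holds M v w ↔
    (∀ z ∈ w f.idx, ∃ p q r s, z = boxNat p q r s ∧ (p < q ∧ p < 1 ∧ 0 < q) ∧ r < s) ∧
    (∀ p q r s, boxNat p q r s ∈ w f.idx → ∀ r' s', boxNat p q r' s' ∈ w f.idx →
      r < s' ∧ r' < s) ∧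
    (∀ p q r s, boxNat p q r s ∈ w f.idx → ∀ p' q', (p' < q' ∧ p' < 1 ∧ 0 < q') ∧
      (p < 0 ∨ p ≤ p') ∧ (1 < q ∨ q' ≤ q) → boxNat p' q' r s ∈ w f.idx) ∧
    (∀ p q r s, boxNat p q r s ∈ w f.idx → ∀ r' s', r' ≤ r ∧ s ≤ s' →
      boxNat p q r' s' ∈ w f.idx) := by
  simp only [isContFun, allBox, holds_allQ, holds_exQ, Formula.Holds, Formula.holds_allN,
    Term.eval_lift, Term.eval_var_zero, eval_boxCode, RatTerm.code_lift_eval,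
    RatTerm.code_fraction, natPair_eq_boxNat, isBasicUnit, unitSubset]
  simp [RatTerm.holds_lt, RatTerm.holds_le]

theorem holds_isEntry {P : SetVar m} {i : Term n} : (isEntry P i X : Formula n m).Holds M v w ↔
    (∃ x, IsRealCode (w X.idx) x) ∧ w X.idx = {z | natPair (i.eval v) z ∈ w P.idx} := by
  simp [isEntry, Formula.Holds, holds_isReal, Set.ext_iff]

end Reals

end SOA

namespace SOA

/-! ### The counterexample in the `ω`-model of the computable sets -/

section Gauge

variable {ψ : ℕ → ℚ × ℚ} {n m : ℕ} {v : Fin n → ℕ} {w : Fin m → Set ℕ} {f X Y : SetVar m}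

theorem holds_isContFun_codeSet (M : Set (Set ℕ)) (hf : w f.idx = codeSet ψ) :
    (isContFun f : Formula n m).Holds M v w := by
  rw [holds_isContFun, hf]
  simp only [boxNat_mem_codeSet]
  refine ⟨?_, fun p q r s h r' s' h' => ⟨h.lt h', h'.lt h⟩,
    fun p q r s h p' q' h' => h.mono_left h'.1.1 h'.1.2.1 h'.1.2.2 h'.2.1 h'.2.2,
    fun p q r s h r' s' h' => h.mono_right h'.1 h'.2⟩
  rintro z ⟨p, q, r, s, rfl, h⟩
  exact ⟨p, q, r, s, rfl, ⟨h.1, h.2.1, h.2.2.1⟩, h.lt h⟩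

theorem holds_inDomain_codeSet (M : Set (Set ℕ)) (hf : w f.idx = codeSet ψ) {x : ℝ}
    (hx : x ∈ Set.Icc (0 : ℝ) 1) (hX : IsRealCode (w X.idx) x) :
    (inDomain f X : Formula n m).Holds M v w := by
  rw [holds_inDomain hX, hf]
  intro η hη
  obtain ⟨p, q, r, s, h, h₁, h₂, h₃⟩ := exists_inCode ψ hx hη
  exact ⟨p, q, r, s, boxNat_mem_codeSet.2 h, ⟨hx, h₁, h₂⟩, h₃⟩

/-- The value is pinned down because the boxes at `x` have arbitrarily short value intervals, each
containing the sum of spikes at `x`. -/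
theorem holds_isValue_codeSet (M : Set (Set ℕ)) (hf : w f.idx = codeSet ψ) {x y : ℝ}
    (hx : x ∈ Set.Icc (0 : ℝ) 1) (hX : IsRealCode (w X.idx) x) (hY : IsRealCode (w Y.idx) y) :
    (isValue f X Y : Formula n m).Holds M v w ↔ y = spikeSum ψ x := by
  simp only [holds_isValue hX hY, holds_inDomain_codeSet M hf hx hX, true_and, hf,
    boxNat_mem_codeSet]
  constructor
  · intro h
    refine eq_of_forall_dist_le fun ε hε => ?_
    obtain ⟨η, hη, hηε⟩ := exists_rat_btwn hε
    obtain ⟨p, q, r, s, hc, h₁, h₂, h₃⟩ := exists_inCode ψ hx (mod_cast hη : 0 < η)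
    have h4 := hc.spikeSum_mem hx h₁ h₂
    have h5 := h p q r s hc ⟨hx, h₁, h₂⟩
    have h6 : (s : ℝ) - r ≤ η := mod_cast h₃
    rw [Real.dist_eq, abs_le]
    constructor <;> linarith
  · rintro rfl p q r s hc h
    have := hc.spikeSum_mem hx h.2.1 h.2.2
    exact ⟨this.1.le, this.2.le⟩

/-- Inside `REC` only computable reals are tested for positivity. The value must also be found in
`REC`, which is what `exists_isRealCode_spikeSum` provides. -/
theorem holds_isTotalContGauge_codeSet (h₁ : QComputable fun k => (ψ k).1)
    (h₂ : QComputable fun k => (ψ k).2)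
    (hpos : ∀ x ∈ Set.Icc (0 : ℝ) 1, IsComputableReal x → 0 < spikeSum ψ x)
    (hf : w f.idx = codeSet ψ) : (isTotalContGauge f : Formula n m).Holds REC v w := by
  refine ⟨holds_isContFun_codeSet REC hf, fun A hA hU => ?_, fun A hA hU => ?_⟩ <;>
    obtain ⟨x, hx, hA'⟩ := holds_inUnit.1 hU
  · exact holds_inDomain_codeSet REC hf hx hA'
  · obtain ⟨B, hB, hB'⟩ := exists_isRealCode_spikeSum h₁ h₂ hA hA'
    refine ⟨B, hB, (holds_isValue_codeSet REC (ψ := ψ) (by exact hf) hx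
      (by exact hA') (by exact hB')).2 rfl, fun h => ?_⟩
    have := (holds_realLeRat (by exact hB') (by simp)).1 h
    simp only [RatTerm.eval_zero, Rat.cast_zero] at this
    exact absurd (hpos x hx (hA'.isComputableReal hA)) (not_lt.2 this)

theorem not_holds_hasFinePartition_codeSet
    (hψ : ¬ HasComputableFinePartition (spikeSum ψ)) (hf : w f.idx = codeSet ψ) :
    ¬ (hasFinePartition f : Formula n m).Holds REC v w := by
  rintro ⟨P, hP, ℓ, ⟨-, hent, h0, h1, hlt⟩, hfine⟩
  simp only [Formula.holds_allN, Formula.holds_exS, Formula.Holds, holds_isEntry, holds_le,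
    Term.eval, Term.eval_lift, Fin.cons_zero, SetVar.cons_lift] at hent h0 h1 hlt
  -- The `i`-th section of `P` determines an actual real number; beyond the last place 0 is a dummy
  -- value.
  have hent' : ∀ i, ∃ x, i ≤ ℓ + ℓ → {z | natPair i z ∈ P} ∈ REC ∧
      IsRealCode {z | natPair i z ∈ P} x := fun i => by
    by_cases hi : i ≤ ℓ + ℓ
    · obtain ⟨A, hA, ⟨x, hx⟩, hAi⟩ := hent i hi
      exact ⟨x, fun _ => ⟨hAi ▸ hA, hAi ▸ hx⟩⟩
    · exact ⟨0, fun h => absurd h hi⟩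
  choose c hc using hent'
  -- The formulae quantify each entry afresh; as entries equal sections of `P`, all these sets code
  -- the same reals `c i`.
  have hcode : ∀ {i : ℕ} {A : Set ℕ}, i ≤ ℓ + ℓ → A = {z | natPair i z ∈ P} →
      IsRealCode A (c i) := fun hi hA => hA ▸ (hc _ hi).2
  have hx0 : c 0 = 0 := by
    obtain ⟨A, -, ⟨-, hA⟩, h, h'⟩ := h0
    have hA := hcode (Nat.zero_le _) hA
    rw [holds_ratLeReal (by exact hA) (by simp)] at h
    rw [holds_realLeRat (by exact hA) (by simp)] at h'
    exact le_antisymm (by simpa using h') (by simpa using h)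
  have hx1 : c (ℓ + ℓ) = 1 := by
    obtain ⟨A, -, ⟨-, hA⟩, h, h'⟩ := h1
    have hA := hcode le_rfl hA
    rw [holds_ratLeReal (by exact hA) (by simp)] at h
    rw [holds_realLeRat (by exact hA) (by simp)] at h'
    exact le_antisymm (by simpa using h') (by simpa using h)
  have hstep : ∀ j < ℓ, c (j + j) < c (j + j + 1) ∧ c (j + j + 1) < c (j + 1 + (j + 1)) := by
    intro j hj
    obtain ⟨A, -, B, -, C, -, ⟨-, hA⟩, ⟨-, hB⟩, ⟨-, hC⟩, h, h'⟩ := hlt j hj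
    have hA := hcode (by omega) hA
    have hB := hcode (by omega) hB
    have hC := hcode (by omega) hC
    rw [realLt, Formula.Holds, holds_realLe (by exact hB) (by exact hA), not_le] at h
    rw [realLt, Formula.Holds, holds_realLe (by exact hC) (by exact hB), not_le] at h'
    exact ⟨h, by rwa [show j + 1 + (j + 1) = j + j + 1 + 1 by omega]⟩
  have hlo : ∀ j ≤ ℓ, 0 ≤ c (j + j) := fun j hj => by
    induction j with
    | zero => exact hx0.ge
    | succ j ih => linarith [ih (by omega), hstep j (by omega)]
  have hhi : ∀ k j, j + k = ℓ → c (j + j) ≤ 1 := fun k => by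
    induction k with
    | zero => rintro j rfl; exact hx1.le
    | succ k ih => exact fun j hj => by linarith [ih (j + 1) (by omega), hstep j (by omega)]
  refine hψ ⟨ℓ, fun j => c (j + j), fun j => c (j + j + 1), hx0, hx1,
    fun j hj => ((hc _ (by omega)).2.isComputableReal (hc _ (by omega)).1),
    fun j hj => ((hc _ (by omega)).2.isComputableReal (hc _ (by omega)).1), hstep, fun j hj => ?_⟩
  obtain ⟨A, -, B, -, C, -, Y, -, hA, hB, hC, hY, h, h'⟩ := hfine j hj
  have hA := hcode (i := j + j) (by omega) (holds_isEntry.1 hA).2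
  have hB := hcode (i := j + j + 1) (by omega) (holds_isEntry.1 hB).2
  have hC := hcode (i := j + j + 1 + 1) (by omega) (holds_isEntry.1 hC).2
  obtain ⟨y, hy⟩ := holds_isReal.1 hY.2.1
  -- The tag must lie in [0,1] for its value under the code to be the sum of spikes.
  have hB01 : c (j + j + 1) ∈ Set.Icc (0 : ℝ) 1 :=
    ⟨(hlo j hj.le).trans (hstep j hj).1.le,
      (hstep j hj).2.le.trans (hhi (ℓ - (j + 1)) (j + 1) (by omega))⟩
  obtain rfl := (holds_isValue_codeSet REC (by exact hf) hB01 (by exact hB) hy).1 hY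
  refine ⟨(holds_subLe (by exact hB) (by exact hy) (by exact hA)).1 h, ?_⟩
  beta_reduce
  rw [show j + 1 + (j + 1) = j + j + 1 + 1 by omega]
  exact (holds_leAdd (by exact hC) (by exact hB) (by exact hy)).1 h'

end Gauge

end SOA

/-! ### The main theorem -/

theorem mainTheorem4 :
    ¬ SOA.Proves SOA.RCA0 SOA.CLc ∧
    (∀ φ ∈ SOA.RCA0, SOA.Models SOA.REC φ) ∧
    ¬ SOA.Models SOA.REC SOA.CLc ∧
    ∃ ψ : ℕ → ℚ × ℚ,
      Computable (fun k => SOA.natPair (SOA.ratCode (ψ k).1) (SOA.ratCode (ψ k).2)) ∧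
      (SOA.piClass ψ).Nonempty ∧
      (∀ x ∈ SOA.piClass ψ, ¬ SOA.IsComputableReal x) ∧
      (∀ x y : ℝ, |SOA.spikeSum ψ x - SOA.spikeSum ψ y| ≤ |x - y|) ∧
      (∀ x ∈ Set.Icc (0 : ℝ) 1, 0 < SOA.spikeSum ψ x ↔ x ∉ SOA.piClass ψ) ∧
      (∀ x ∈ Set.Icc (0 : ℝ) 1, SOA.IsComputableReal x → 0 < SOA.spikeSum ψ x) ∧
      ¬ SOA.HasComputableFinePartition (SOA.spikeSum ψ) ∧
      ∃ f ∈ SOA.REC,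
        SOA.CodesFunction f (SOA.spikeSum ψ) ∧
        (SOA.isTotalContGauge ⟨0⟩ : SOA.Formula 0 1).Holds SOA.REC ![] ![f] ∧
        ¬ (SOA.hasFinePartition ⟨0⟩ : SOA.Formula 0 1).Holds SOA.REC ![] ![f] := by
  have h₁ : SOA.QComputable fun k => (SOA.cover k).1 :=
    SOA.qcomputable_coverCenter.sub SOA.qcomputable_coverRadius
  have h₂ : SOA.QComputable fun k => (SOA.cover k).2 :=
    SOA.qcomputable_coverCenter.add SOA.qcomputable_coverRadius
  have hpos : ∀ x ∈ Set.Icc (0 : ℝ) 1, SOA.IsComputableReal x → 0 < SOA.spikeSum SOA.cover x :=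
    fun _ => SOA.spikeSum_cover_pos
  have hf := SOA.codeSet_mem_REC h₁ h₂
  have hgauge : (SOA.isTotalContGauge ⟨0⟩ : SOA.Formula 0 1).Holds SOA.REC ![]
      ![SOA.codeSet SOA.cover] :=
    SOA.holds_isTotalContGauge_codeSet h₁ h₂ hpos rfl
  have hfine : ¬ (SOA.hasFinePartition ⟨0⟩ : SOA.Formula 0 1).Holds SOA.REC ![]
      ![SOA.codeSet SOA.cover] :=
    SOA.not_holds_hasFinePartition_codeSet SOA.not_hasComputableFinePartition_spikeSum_cover rfl
  have hCL : ¬ SOA.Models SOA.REC SOA.CLc := fun h => hfine (h _ hf hgauge)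
  exact ⟨fun h => hCL (h.models SOA.models_RCA0), SOA.models_RCA0, hCL, SOA.cover,
    h₁.ratCode.natPair h₂.ratCode, SOA.piClass_cover_nonempty,
    fun x => SOA.not_isComputableReal_of_mem_piClass_cover, SOA.abs_spikeSum_sub_le _,
    fun x => SOA.spikeSum_pos_iff _, hpos, SOA.not_hasComputableFinePartition_spikeSum_cover,
    _, hf, SOA.codesFunction_codeSet _, hgauge, hfine⟩
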